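/- Let $p$ be a prime, let $K$ be a complete normed field extending $\mathbf{Q}_p$ (for instance $\mathbf{C}_p$ or a finite extension of $\mathbf{Q}_p$), with absolute value extending that of $\mathbf Q_p$, and let $a_p,\varepsilon\in K$ with $|a_p|\le 1$ and $|\varepsilon|=1$ (for instance the $p$-th Hecke eigenvalue and the value $\varepsilon=\epsilon(p)=\pm1$ of the Nebentypus of a weight $2$ normalized eigenform of level prime to $p$). Suppose $X^2-a_pX+\varepsilon p=(X-\alpha)(X-\beta)$ with $\alpha,\beta\in K$ and $|\alpha|\ge|\beta|$. The case $|a_p|<1$ is called supersingular, the case $|a_p|=1$ ordinary. For $n\ge0$ put $$R_n=\begin{pmatrix}a_p&1\\-\varepsilon p&0\end{pmatrix}^{-c-n}\begin{pmatrix}-1&-1\\ \beta&\alpha\end{pmatrix},\qquad c=2\text{ if }p\ge3,\quad c=3\text{ if }p=2,$$ $$\mathcal{L}og^{(n)}_{a_p}(1+T)=\begin{pmatrix}a_p&1\\-\varepsilon\Phi_p(1+T)&0\end{pmatrix}\begin{pmatrix}a_p&1\\-\varepsilon\Phi_{p^2}(1+T)&0\end{pmatrix}\cdots\begin{pmatrix}a_p&1\\-\varepsilon\Phi_{p^n}(1+T)&0\end{pmatrix}R_n,$$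 where $\Phi_{p^i}$ is the $p^i$-th cyclotomic polynomial, and let $\mathcal{L}og_{a_p}(1+T)=\lim_{n\to\infty}\mathcal{L}og^{(n)}_{a_p}(1+T)$ (coefficient by coefficient in $K[[T]]$). A distribution on $\mathbf{Z}_p$ is a continuous $K$-linear form on the space of locally analytic functions $\mathbf{Z}_p\to K$; its Amice--Mahler transform is $A_\mu(T)=\int_{\mathbf{Z}_p}(1+T)^x\mu(x)=\sum_{k\ge0}\left(\int_{\mathbf{Z}_p}\binom{x}{k}\mu(x)\right)T^k$, and $\mu(b+p^n\mathbf{Z}_p)$ is the integral of the characteristic function of $b+p^n\mathbf{Z}_p$. It is of order $o(\log_p(1+T))$ if $\|A_\mu\|_\rho/\|\log_p(1+T)\|_\rho\to0$ as $\rho\to1^-$, where $\|\sum_k c_kT^k\|_\rho=\sup_k|c_k|\rho^k$. Transforms and values of matrices of distributions are taken entry by entry. Supersingular case. The limit $\mathcal{L}og_{a_p}(1+T)$ exists, and there is a unique $2\times2$ matrix $\mu_{a_p}$ of distributions whose transform is $\mathcal{L}og_{a_p}(1+T)$. Let $n\ge0$ and let $b\in\mathbf{Z}_p$ with $b\equiv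 b_0+b_1p+\dots+b_{n-1}p^{n-1}\pmod{p^n}$, $b_i\in\{0,\dots,p-1\}$. Let $m_1,\dots,m_l\ge0$ be the lengths of the runs of zeros separated by the nonzero digits: $$(b_0,\dots,b_{n-1})=(\underbrace{0,\dots,0}_{m_1},\ne0,\underbrace{0,\dots,0}_{m_2},\ne0,\dots,\ne0,\underbrace{0,\dots,0}_{m_l}).$$ Then, with $Y=\begin{pmatrix}a_p&1\\-\varepsilon&0\end{pmatrix}$ and $N=\begin{pmatrix}0&0\\-\varepsilon&0\end{pmatrix}$, $$\mu_{a_p}(b+p^n\mathbf{Z}_p)=Y^{m_1}\,N\,Y^{m_2}\,N\cdots N\,Y^{m_l}\,R_n.\qquad(*)$$ Moreover the entries of $\mu_{a_p}$ are of order $o(\log_p(1+T))$, and $\mu_{a_p}$ is characterized by $(*)$: it is the only $2\times2$ matrix of distributions of order $o(\log_p(1+T))$ that satisfies $(*)$ for all $n$ and $b$. Ordinary case. The same statements hold for the first column: the first column of $\mathcal{L}og^{(n)}_{a_p}(1+T)$ converges to that of $\mathcal{L}og_{a_p}(1+T)$; there is a unique column of two distributions whose transform is this limit; its value on $b+p^n\mathbf{Z}_p$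 is the first column of the right-hand side of $(*)$; its entries are of order $o(\log_p(1+T))$; and it is the only column of two distributions of order $o(\log_p(1+T))$ with these values for all $n$ and $b$. -/

import Mathlib

open Filter Topology

noncomputable section

namespace PadicLog

section Distributions

variable (p : ℕ) [Fact p.Prime] (K : Type*) [NormedField K] [NormedAlgebra ℚ_[p] K]

/-- The embedding of `ℤ_p` into an extension `K` of `ℚ_p`. -/
def emb (x : ℤ_[p]) : K := algebraMap ℚ_[p] K (x : ℚ_[p])

variable {p K}

/-- `f : ℤ_p → K` is analytic on every ball `a + p^h ℤ_p`, with the expansion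
`f (a + p^h z) = ∑ c a k * z^k` (`z ∈ ℤ_p`), where `c a k → 0` as `k → ∞`. -/
def HasBallExpansion (h : ℕ) (f : ℤ_[p] → K) (c : ℤ_[p] → ℕ → K) : Prop :=
  ∀ a : ℤ_[p], Tendsto (c a) atTop (𝓝 0) ∧
    ∀ z : ℤ_[p], HasSum (fun k : ℕ => c a k * emb p K z ^ k) (f (a + (p : ℤ_[p]) ^ h * z))

theorem norm_emb_le_one (x : ℤ_[p]) : ‖emb p K x‖ ≤ 1 := by
  rw [emb, norm_algebraMap']
  exact x.norm_le_one

theorem HasBallExpansion.mono {h h' : ℕ} (hh : h ≤ h') {f : ℤ_[p] → K} {c : ℤ_[p] → ℕ → K}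
    (hf : HasBallExpansion h f c) :
    HasBallExpansion h' f (fun a k => c a k * emb p K ((p : ℤ_[p]) ^ (h' - h)) ^ k) := by
  intro a
  refine ⟨squeeze_zero_norm (fun k => ?_) (tendsto_zero_iff_norm_tendsto_zero.1 (hf a).1),
    fun z => ?_⟩
  · rw [norm_mul, norm_pow]
    exact mul_le_of_le_one_right (norm_nonneg _)
      (pow_le_one₀ (norm_nonneg _) (norm_emb_le_one _))
  · have h1 := (hf a).2 ((p : ℤ_[p]) ^ (h' - h) * z)
    have h2 : a + (p : ℤ_[p]) ^ h * ((p : ℤ_[p]) ^ (h' - h) * z) = a + (p : ℤ_[p]) ^ h' * z := by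
      rw [← mul_assoc, ← pow_add, Nat.add_sub_cancel' hh]
    rw [h2] at h1
    convert h1 using 2 with k
    simp [emb, mul_pow, mul_assoc]

variable (p K)

/-- The space `LA(ℤ_p, K)` of locally analytic functions `ℤ_p → K`. -/
def LocAnalytic : Submodule K (ℤ_[p] → K) where
  carrier := {f | ∃ (h : ℕ) (c : ℤ_[p] → ℕ → K), HasBallExpansion h f c}
  zero_mem' := ⟨0, 0, fun a => ⟨tendsto_const_nhds, fun z => by simp⟩⟩
  add_mem' := by
    rintro f g ⟨h₁, c, hc⟩ ⟨h₂, d, hd⟩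
    have hc' := hc.mono (le_max_left h₁ h₂)
    have hd' := hd.mono (le_max_right h₁ h₂)
    refine ⟨max h₁ h₂, fun a k => c a k * emb p K ((p : ℤ_[p]) ^ (max h₁ h₂ - h₁)) ^ k +
      d a k * emb p K ((p : ℤ_[p]) ^ (max h₁ h₂ - h₂)) ^ k, fun a => ⟨?_, fun z => ?_⟩⟩
    · simpa using (hc' a).1.add (hd' a).1
    · simpa [add_mul] using ((hc' a).2 z).add ((hd' a).2 z)
  smul_mem' := by
    rintro s f ⟨h, c, hc⟩
    refine ⟨h, fun a k => s * c a k, fun a => ⟨?_, fun z => ?_⟩⟩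
    · simpa using (hc a).1.const_mul s
    · simpa [mul_assoc] using ((hc a).2 z).mul_left s

/-- A distribution on `ℤ_p` with values in `K`: a continuous linear form on `LA(ℤ_p, K)`, the
inductive limit of the Banach spaces of functions analytic on all balls of radius `p^(-h)`.
Continuity is boundedness on each of these Banach spaces, where the norm of a function is the
supremum of the norms of the coefficients of its expansions. -/
structure Distribution where
  toLinearMap : LocAnalytic p K →ₗ[K] K
  bounded : ∀ h : ℕ, ∃ B : ℝ, ∀ (f : LocAnalytic p K) (c : ℤ_[p] → ℕ → K) (M : ℝ),
    HasBallExpansion h f c → (∀ a k, ‖c a k‖ ≤ M) → ‖toLinearMap f‖ ≤ B * M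

variable {p}

theorem eval_mem_locAnalytic (P : Polynomial K) :
    (fun x : ℤ_[p] => P.eval (emb p K x)) ∈ LocAnalytic p K := by
  refine ⟨0, fun a k => (Polynomial.taylor (emb p K a) P).coeff k, fun a => ⟨?_, fun z => ?_⟩⟩
  · refine tendsto_const_nhds.congr' ?_
    filter_upwards [eventually_gt_atTop (Polynomial.taylor (emb p K a) P).natDegree] with k hk
    exact (Polynomial.coeff_eq_zero_of_natDegree_lt hk).symm
  · have h1 : P.eval (emb p K (a + (p : ℤ_[p]) ^ 0 * z))
        = (Polynomial.taylor (emb p K a) P).eval (emb p K z) := by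
      rw [Polynomial.taylor_eval]
      simp [emb, add_comm]
    simp only [h1]
    rw [Polynomial.eval_eq_sum_range]
    refine hasSum_sum_of_ne_finset_zero fun k hk => ?_
    rw [Polynomial.coeff_eq_zero_of_natDegree_lt (by simpa [Nat.lt_succ_iff] using hk), zero_mul]

theorem choose_mem_locAnalytic (k : ℕ) :
    (fun x : ℤ_[p] => emb p K (Ring.choose x k)) ∈ LocAnalytic p K := by
  have : CharZero K := charZero_of_injective_algebraMap (algebraMap ℚ_[p] K).injective
  convert eval_mem_locAnalytic (p := p) K
    (Polynomial.C (k.factorial : K)⁻¹ * (descPochhammer ℤ k).map (Int.castRingHom K)) using 2 with x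
  have h1 := Ring.descPochhammer_eq_factorial_smul_choose x k
  rw [← Polynomial.aeval_eq_smeval, nsmul_eq_mul] at h1
  have h2 := congrArg ((algebraMap ℚ_[p] K).comp PadicInt.Coe.ringHom) h1
  have h3 : (k.factorial : K) ≠ 0 := Nat.cast_ne_zero.2 k.factorial_ne_zero
  rw [map_mul, map_natCast, Polynomial.aeval_def, Polynomial.hom_eval₂] at h2
  rw [Polynomial.eval_mul, Polynomial.eval_C, Polynomial.eval_map, eq_inv_mul_iff_mul_eq₀ h3]
  rw [Subsingleton.elim (((algebraMap ℚ_[p] K).comp PadicInt.Coe.ringHom).comp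
    (algebraMap ℤ ℤ_[p])) (Int.castRingHom K)] at h2
  exact h2.symm

/-- The binomial coefficient `x ↦ (x choose k)` as a locally analytic function. -/
def chooseFun (k : ℕ) : LocAnalytic p K :=
  ⟨fun x => emb p K (Ring.choose x k), choose_mem_locAnalytic K k⟩

/-- The ball `b + p^n ℤ_p`. -/
def ball (b : ℤ_[p]) (n : ℕ) : Set ℤ_[p] := {x | ∃ z : ℤ_[p], x = b + (p : ℤ_[p]) ^ n * z}

theorem indicator_ball_mem_locAnalytic (b : ℤ_[p]) (n : ℕ) :
    (ball b n).indicator (fun _ => (1 : K)) ∈ LocAnalytic p K := by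
  refine ⟨n, fun a k => if k = 0 then (ball b n).indicator (fun _ => (1 : K)) a else 0,
    fun a => ⟨?_, fun z => ?_⟩⟩
  · refine tendsto_const_nhds.congr' ?_
    filter_upwards [eventually_gt_atTop 0] with k hk
    rw [if_neg hk.ne']
  · have h1 : (a + (p : ℤ_[p]) ^ n * z ∈ ball b n) ↔ a ∈ ball b n := by
      constructor
      · rintro ⟨w, hw⟩
        exact ⟨w - z, by linear_combination hw⟩
      · rintro ⟨w, hw⟩
        exact ⟨w + z, by linear_combination hw⟩
    have h2 : (ball b n).indicator (fun _ => (1 : K)) (a + (p : ℤ_[p]) ^ n * z)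
        = (ball b n).indicator (fun _ => (1 : K)) a := by
      by_cases h : a ∈ ball b n
      · rw [Set.indicator_of_mem h, Set.indicator_of_mem (h1.2 h)]
      · rw [Set.indicator_of_notMem h, Set.indicator_of_notMem (fun h' => h (h1.1 h'))]
    rw [h2]
    convert hasSum_single (0 : ℕ) _ using 1
    · simp
    · intro k hk
      simp [hk]

/-- The characteristic function of `b + p^n ℤ_p` as a locally analytic function. -/
def ballFun (b : ℤ_[p]) (n : ℕ) : LocAnalytic p K :=
  ⟨(ball b n).indicator (fun _ => 1), indicator_ball_mem_locAnalytic K b n⟩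

variable {K}

/-- `μ (b + p^n ℤ_p)`, the integral of the characteristic function of the ball. -/
def Distribution.onBall (μ : Distribution p K) (b : ℤ_[p]) (n : ℕ) : K :=
  μ.toLinearMap (ballFun K b n)

/-- The Amice–Mahler transform `∫ (1+T)^x μ(x) = ∑ (∫ (x choose k) μ(x)) T^k`. -/
def Distribution.transform (μ : Distribution p K) : PowerSeries K :=
  PowerSeries.mk fun k => μ.toLinearMap (chooseFun K k)

/-- `F = o(log_p(1+T))`: with `‖F‖_ρ = sup_k |F_k| ρ^k` the sup norm on the disc of radius `ρ`,
for each `δ > 0` one has `‖F‖_ρ ≤ δ ‖log_p(1+T)‖_ρ` for all `ρ < 1` close to `1`.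
(`PowerSeries.log` is the series of `log(1+T)`.) -/
def IsLittleOLog (p : ℕ) [Fact p.Prime] {K : Type*} [NormedField K] (F : PowerSeries K) : Prop :=
  ∀ δ : ℝ, 0 < δ → ∀ᶠ ρ : ℝ in 𝓝[<] 1, ∀ k : ℕ, ‖F.coeff k‖ * ρ ^ k ≤
    δ * PowerSeries.gaussNorm (fun x : ℚ_[p] => ‖x‖) ρ (PowerSeries.log ℚ_[p])

/-- The distribution `μ` is of order `o(log_p(1+T))`. -/
def Distribution.IsLittleOLog (μ : Distribution p K) : Prop :=
  PadicLog.IsLittleOLog p μ.transform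

/-- The value on `b + p^n ℤ_p` of a matrix of distributions. -/
def matrixOnBall {ι κ : Type*} (μ : Matrix ι κ (Distribution p K)) (b : ℤ_[p]) (n : ℕ) :
    Matrix ι κ K :=
  μ.map fun ν => ν.onBall b n

/-- The transform of a matrix of distributions. -/
def matrixTransform {ι κ : Type*} (μ : Matrix ι κ (Distribution p K)) :
    Matrix ι κ (PowerSeries K) :=
  μ.map fun ν => ν.transform

end Distributions

section LogMatrix

variable (p : ℕ) {K : Type*} [NormedField K] (a ε α β : K)

/-- The matrix of roots `R_n`. -/
def rootMatrix (n : ℕ) : Matrix (Fin 2) (Fin 2) K :=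
  (!![a, 1; -ε * p, 0]⁻¹) ^ ((if p = 2 then 3 else 2) + n) * !![-1, -1; β, α]

/-- The factor `[[a, 1], [-ε Φ_{p^i}(1+T), 0]]`. -/
def logFactor (i : ℕ) : Matrix (Fin 2) (Fin 2) (Polynomial K) :=
  !![Polynomial.C a, 1;
    -Polynomial.C ε * (Polynomial.cyclotomic (p ^ i) K).comp (1 + Polynomial.X), 0]

/-- `Log^{(n)}(1+T)`: the product of the factors for `i = 1, …, n`, in this order, and `R_n`. -/
def logApprox (n : ℕ) : Matrix (Fin 2) (Fin 2) (Polynomial K) :=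
  ((List.range n).map fun i => logFactor p a ε (i + 1)).prod *
    (rootMatrix p a ε α β n).map Polynomial.C

/-- The logarithm matrix, `lim_n Log^{(n)}(1+T)`, the limit being taken coefficient by coefficient
(an entry is meaningful only where these limits exist). -/
def logMatrix : Matrix (Fin 2) (Fin 2) (PowerSeries K) :=
  Matrix.of fun i j => PowerSeries.mk fun k =>
    limUnder atTop fun n : ℕ => (logApprox p a ε α β n i j).coeff k

/-- The lengths `m_1, …, m_l` of the runs of zeros separated by the nonzero digits
(some of the lengths may be `0`). -/
def zeroRuns (d : List ℕ) : List ℕ := (d.splitOnP fun x => x ≠ 0).map List.length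

/-- `Y^{m_1} N Y^{m_2} N ⋯ N Y^{m_l}`, with `Y = [[a, 1], [-ε, 0]]` and `N = [[0, 0], [-ε, 0]]`. -/
def digitProduct (d : List ℕ) : Matrix (Fin 2) (Fin 2) K :=
  (((zeroRuns d).map fun m => !![a, 1; -ε, 0] ^ m).intersperse !![0, 0; -ε, 0]).prod

end LogMatrix

/-- `d = (b_0, …, b_{n-1})` are the first `n` base-`p` digits of `b ∈ ℤ_p`. -/
def HasDigits {p : ℕ} [Fact p.Prime] (b : ℤ_[p]) {n : ℕ} (d : Fin n → Fin p) : Prop :=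
  b - ∑ i : Fin n, ((d i : ℕ) : ℤ_[p]) * (p : ℤ_[p]) ^ (i : ℕ) ∈ Ideal.span {(p : ℤ_[p]) ^ n}

/-- The value predicted on `b + p^n ℤ_p`, where `d` are the first `n` digits of `b`. -/
def digitValue (p : ℕ) {K : Type*} [NormedField K] (a ε α β : K) {n : ℕ} (d : Fin n → Fin p) :
    Matrix (Fin 2) (Fin 2) K :=
  digitProduct a ε (List.ofFn fun i => (d i : ℕ)) * rootMatrix p a ε α β n

end PadicLog

end

open PadicLog

/-! Since $\Phi_{p^{i+1}}(1+T)=\sum_{j<p}(1+T)^{p^i j}$, each factor of the product is a sum over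
one base-$p$ digit, with matrix $Y$ for the digit $0$ and $N$ for the others. Expanding gives
$\mathcal{L}og^{(n)}=\sum_{x<p^n}(1+T)^x V_n(x)$, where $V_n(x)$ is the right-hand side of $(*)$.
Thus $\mathcal{L}og^{(n)}$ is the $n$-th Riemann sum of $(1+T)^x$ for the masses $V_n$, and
everything reduces to showing that these masses define a distribution.

Two facts about $V_n$ are needed. They are additive: summing over the last digit produces
$C=\begin{pmatrix}a&1\\-\varepsilon p&0\end{pmatrix}$, and $CR_{n+1}=R_n$. They grow moderately: the
digit matrices have integral entries, while the columns of $\begin{pmatrix}-1&-1\\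
\beta&\alpha\end{pmatrix}$ are eigenvectors of $C$ for $\alpha$ and $\beta$, so the two columns of
$V_n$ are $O(|\alpha|^{-n})$ and $O(|\beta|^{-n})$. As $|\alpha||\beta|=1/p$, both rates are below
$p$ when $|a|<1$; when $|a|=1$ only the first is.

For masses of size $O(t^n)$ with $t<p$, Riemann sums of a function analytic at level $h$ change by
$O((t/p)^n)$, so they converge, with norm $O(t^h)$ at level $h$ (`exists_distribution`). Since
$\binom{x}{k}$ has norm at most $1$ at level $h$ for $k<p^h$, the order is $o(\log)$.

Uniqueness has two sources. Mahler series of locally analytic functions converge in a slightly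
larger level, so the transform determines the distribution. A distribution of order $o(\log)$ has
norm $o(p^n)$ at level $n$, whereas step functions approximate to within $O(p^{-n})$ there, so its
values on balls determine it. -/

namespace PadicLog

/-! ### Nonarchimedean rearrangement of triangular double series. -/

section Nonarchimedean

variable {K : Type*} [NormedField K] [IsUltrametricDist K]

/-- Only pairs with $j\le k<N$ can carry a large term, and they are finitely many; in an ultrametric
complete field this suffices for summability. -/
theorem summable_triangular [CompleteSpace K] {u : ℕ → ℕ → K} {t : ℕ → ℝ}
    (hu0 : ∀ k j, k < j → u k j = 0) (hu : ∀ k j, ‖u k j‖ ≤ t k) (ht : Tendsto t atTop (𝓝 0)) {z : K} (hz : ‖z‖ ≤ 1) :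
    Summable fun x : ℕ × ℕ => u x.1 x.2 * z ^ x.2 := by
  refine NonarchimedeanAddGroup.summable_of_tendsto_cofinite_zero ?_
  rw [tendsto_zero_iff_norm_tendsto_zero, Metric.tendsto_nhds]
  intro δ hδ
  obtain ⟨N, hN⟩ := eventually_atTop.1 (ht.eventually (gt_mem_nhds hδ))
  refine Set.Finite.subset (Finset.finite_toSet (Finset.range N ×ˢ Finset.range N)) ?_
  rintro ⟨k, j⟩ hkj
  by_contra h
  apply hkj
  have hle : ‖u k j * z ^ j‖ ≤ ‖u k j‖ := by
    rw [norm_mul, norm_pow]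
    exact mul_le_of_le_one_right (norm_nonneg _) (pow_le_one₀ (norm_nonneg _) hz)
  have hlt : ‖u k j‖ < δ := by
    by_cases hk : N ≤ k
    · exact (hu k j).trans_lt (hN k hk)
    · rw [hu0 k j (by simp at h; omega), norm_zero]
      exact hδ
  simpa using hle.trans_lt hlt

theorem norm_tsum_triangular_tendsto {u : ℕ → ℕ → K} {t : ℕ → ℝ}
    (hu0 : ∀ k j, k < j → u k j = 0) (hu : ∀ k j, ‖u k j‖ ≤ t k) (ht : Tendsto t atTop (𝓝 0)) :
    Tendsto (fun j => ∑' k, u k j) atTop (𝓝 0) := by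
  rw [tendsto_zero_iff_norm_tendsto_zero, Metric.tendsto_nhds]
  intro δ hδ
  obtain ⟨N, hN⟩ := eventually_atTop.1 (ht.eventually (gt_mem_nhds (half_pos hδ)))
  filter_upwards [eventually_ge_atTop N] with j hj
  have : ‖∑' k, u k j‖ ≤ δ / 2 := by
    refine IsUltrametricDist.norm_tsum_le_of_forall_le_of_nonneg (half_pos hδ).le fun k => ?_
    by_cases hk : N ≤ k
    · exact (hu k j).trans (hN k hk).le
    · rw [hu0 k j (by omega), norm_zero]
      exact (half_pos hδ).le
  simpa using this.trans_lt (half_lt_self hδ)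

/-- Rearrangement of a sum of polynomials of degree at most `k` according to powers of `z`. -/
theorem hasSum_triangular [CompleteSpace K] {u : ℕ → ℕ → K} {t : ℕ → ℝ}
    (hu0 : ∀ k j, k < j → u k j = 0) (hu : ∀ k j, ‖u k j‖ ≤ t k) (ht : Tendsto t atTop (𝓝 0))
    {z : K} (hz : ‖z‖ ≤ 1) {S : K}
    (hS : HasSum (fun k => ∑ j ∈ Finset.range (k + 1), u k j * z ^ j) S) :
    HasSum (fun j => (∑' k, u k j) * z ^ j) S := by
  have hsum := summable_triangular hu0 hu ht hz
  have h1 : ∀ k, HasSum (fun j => u k j * z ^ j) (∑ j ∈ Finset.range (k + 1), u k j * z ^ j) := by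
    intro k
    refine hasSum_sum_of_ne_finset_zero fun j hj => ?_
    rw [hu0 k j (by simpa using hj), zero_mul]
  have h2 : HasSum (fun x : ℕ × ℕ => u x.1 x.2 * z ^ x.2) S := by
    have h3 := hsum.hasSum
    rwa [(hsum.hasSum.prod_fiberwise h1).unique hS] at h3
  have h3 : HasSum (fun x : ℕ × ℕ => u x.2 x.1 * z ^ x.1) S :=
    (Equiv.prodComm ℕ ℕ).hasSum_iff.1 (by simpa [Function.comp_def] using h2)
  refine h3.prod_fiberwise fun j => ?_
  have hs : Summable fun k => u k j := by
    refine NonarchimedeanAddGroup.summable_of_tendsto_cofinite_zero ?_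
    rw [Nat.cofinite_eq_atTop]
    exact squeeze_zero_norm (fun k => hu k j) ht
  exact hs.hasSum.mul_right _

end Nonarchimedean

/-! ### Locally analytic functions: norms, recentring and decay of differences. -/

section BallExpansions

variable {p : ℕ} [Fact p.Prime] {K : Type*} [NormedField K] [NormedAlgebra ℚ_[p] K]

@[simp] theorem emb_zero : emb p K 0 = 0 := by simp [emb]

@[simp] theorem emb_one : emb p K 1 = 1 := by simp [emb]

theorem emb_add (x y : ℤ_[p]) : emb p K (x + y) = emb p K x + emb p K y := by simp [emb]

theorem emb_mul (x y : ℤ_[p]) : emb p K (x * y) = emb p K x * emb p K y := by simp [emb]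

@[simp] theorem emb_natCast (n : ℕ) : emb p K (n : ℤ_[p]) = n := by simp [emb]

theorem norm_emb (x : ℤ_[p]) : ‖emb p K x‖ = ‖x‖ := by simp [emb]

theorem emb_sum {ι : Type*} (s : Finset ι) (f : ι → ℤ_[p]) :
    emb p K (∑ i ∈ s, f i) = ∑ i ∈ s, emb p K (f i) := by simp [emb]

/-- `f` is analytic on the balls of radius `p^(-h)`, with norm at most `M`. -/
def BddExpansion (h : ℕ) (M : ℝ) (f : ℤ_[p] → K) : Prop :=
  ∃ c, HasBallExpansion h f c ∧ ∀ a k, ‖c a k‖ ≤ M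

theorem BddExpansion.nonneg {h : ℕ} {M : ℝ} {f : ℤ_[p] → K} (hf : BddExpansion h M f) : 0 ≤ M := by
  obtain ⟨c, -, hc⟩ := hf
  exact (norm_nonneg _).trans (hc 0 0)

theorem BddExpansion.mono {h : ℕ} {M M' : ℝ} (hM : M ≤ M') {f : ℤ_[p] → K}
    (hf : BddExpansion h M f) : BddExpansion h M' f := by
  obtain ⟨c, hc, hb⟩ := hf
  exact ⟨c, hc, fun a k => (hb a k).trans hM⟩

theorem BddExpansion.const_mul {h : ℕ} {M : ℝ} {f : ℤ_[p] → K} (hf : BddExpansion h M f) (s : K) :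
    BddExpansion h (‖s‖ * M) (fun x => s * f x) := by
  obtain ⟨c, hc, hb⟩ := hf
  refine ⟨fun a k => s * c a k, fun a => ⟨by simpa using (hc a).1.const_mul s, fun z => ?_⟩,
    fun a k => ?_⟩
  · simpa [mul_assoc] using ((hc a).2 z).mul_left s
  · rw [norm_mul]
    exact mul_le_mul_of_nonneg_left (hb a k) (norm_nonneg _)

theorem BddExpansion.shift {h : ℕ} {M : ℝ} {f : ℤ_[p] → K} (hf : BddExpansion h M f)
    (y : ℤ_[p]) : BddExpansion h M (fun x => f (x + y)) := by
  obtain ⟨c, hc, hb⟩ := hf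
  refine ⟨fun a => c (a + y), fun a => ⟨(hc _).1, fun z => ?_⟩, fun a k => hb _ _⟩
  simpa [add_right_comm] using (hc (a + y)).2 z

theorem bddExpansion_zero (h : ℕ) {M : ℝ} (hM : 0 ≤ M) :
    BddExpansion h M (fun _ : ℤ_[p] => (0 : K)) :=
  ⟨fun _ _ => 0, fun _ => ⟨tendsto_const_nhds, fun z => by simp⟩,
    fun _ _ => by simpa using hM⟩

theorem exists_eq_natCast_add (a : ℤ_[p]) (h : ℕ) :
    ∃ r < p ^ h, ∃ w : ℤ_[p], a = (r : ℤ_[p]) + (p : ℤ_[p]) ^ h * w := by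
  obtain ⟨w, hw⟩ := Ideal.mem_span_singleton.1 (PadicInt.appr_spec h a)
  exact ⟨a.appr h, PadicInt.appr_lt a h, w, by rw [← hw]; ring⟩

variable [IsUltrametricDist K]

theorem BddExpansion.add {h : ℕ} {M : ℝ} {f g : ℤ_[p] → K} (hf : BddExpansion h M f)
    (hg : BddExpansion h M g) : BddExpansion h M (fun x => f x + g x) := by
  obtain ⟨c, hc, hb⟩ := hf
  obtain ⟨d, hd, hb'⟩ := hg
  refine ⟨fun a k => c a k + d a k,
    fun a => ⟨by simpa using (hc a).1.add (hd a).1, fun z => ?_⟩, fun a k => ?_⟩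
  · simpa [add_mul] using ((hc a).2 z).add ((hd a).2 z)
  · exact (IsUltrametricDist.norm_add_le_max _ _).trans (max_le (hb a k) (hb' a k))

theorem BddExpansion.sum {ι : Type*} (s : Finset ι) {h : ℕ} {M : ℝ} (hM : 0 ≤ M)
    {f : ι → ℤ_[p] → K} (hf : ∀ i ∈ s, BddExpansion h M (f i)) :
    BddExpansion h M (fun x => ∑ i ∈ s, f i x) := by
  classical
  induction s using Finset.induction_on with
  | empty => simpa using bddExpansion_zero h hM
  | insert i s his ih =>
    simp only [Finset.sum_insert his]
    exact (hf i (by simp)).add (ih fun j hj => hf j (by simp [hj]))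

theorem BddExpansion.norm_le {h : ℕ} {M : ℝ} {f : ℤ_[p] → K} (hf : BddExpansion h M f)
    (x : ℤ_[p]) : ‖f x‖ ≤ M := by
  have hM := hf.nonneg
  obtain ⟨c, hc, hb⟩ := hf
  have h1 := (hc x).2 0
  simp only [mul_zero, add_zero] at h1
  rw [← h1.tsum_eq]
  refine IsUltrametricDist.norm_tsum_le_of_forall_le_of_nonneg hM fun k => ?_
  rw [norm_mul, norm_pow]
  exact (mul_le_of_le_one_right (norm_nonneg _)
    (pow_le_one₀ (norm_nonneg _) (norm_emb_le_one _))).trans (hb x k)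

theorem BddExpansion.fwdDiff_iter {h : ℕ} {M : ℝ} {f : ℤ_[p] → K} (hf : BddExpansion h M f)
    (n : ℕ) : BddExpansion h M ((fwdDiff 1)^[n] f) := by
  have h1 : (fwdDiff 1)^[n] f = fun y => ∑ k ∈ Finset.range (n + 1),
      (((-1 : ℤ) ^ (n - k) * n.choose k : ℤ) : K) * f (y + k • 1) := by
    funext y
    rw [fwdDiff_iter_eq_sum_shift]
    simp only [zsmul_eq_mul]
  rw [h1]
  refine BddExpansion.sum _ hf.nonneg fun k _ => ?_
  refine ((hf.shift _).const_mul _).mono ?_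
  exact mul_le_of_le_one_left hf.nonneg (IsUltrametricDist.norm_intCast_le_one K _)

variable [CompleteSpace K]

/-- Change of the centre of a power series converging on the closed unit ball. -/
theorem exists_recentre {e : ℕ → K} (he : Tendsto e atTop (𝓝 0)) {M : ℝ} (hM : ∀ k, ‖e k‖ ≤ M)
    (w : ℤ_[p]) : ∃ e' : ℕ → K, Tendsto e' atTop (𝓝 0) ∧ (∀ k, ‖e' k‖ ≤ M) ∧
      (∀ k, ‖e' k - e k‖ ≤ ‖w‖ * M) ∧ ∀ (z : ℤ_[p]) (S : K),
        HasSum (fun k => e k * emb p K (z + w) ^ k) S →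
          HasSum (fun k => e' k * emb p K z ^ k) S := by
  have hM0 : 0 ≤ M := (norm_nonneg _).trans (hM 0)
  set W := emb p K w with hW
  have hW1 : ‖W‖ ≤ 1 := norm_emb_le_one w
  set u : ℕ → ℕ → K := fun k j => e k * (W ^ (k - j) * (k.choose j : K)) with hu
  have hu0 : ∀ k j, k < j → u k j = 0 := fun k j hkj => by
    simp [hu, Nat.choose_eq_zero_of_lt hkj]
  have hfac : ∀ k j, ‖W ^ (k - j) * (k.choose j : K)‖ ≤ ‖W‖ ^ (k - j) := fun k j => by
    rw [norm_mul, norm_pow]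
    exact mul_le_of_le_one_right (by positivity) (IsUltrametricDist.norm_natCast_le_one K _)
  have hun : ∀ k j, ‖u k j‖ ≤ ‖e k‖ := fun k j => by
    rw [hu, norm_mul]
    exact mul_le_of_le_one_right (norm_nonneg _)
      ((hfac k j).trans (pow_le_one₀ (norm_nonneg _) hW1))
  have ht := tendsto_zero_iff_norm_tendsto_zero.1 he
  have hsum : ∀ j, Summable fun k => u k j := fun j => by
    refine NonarchimedeanAddGroup.summable_of_tendsto_cofinite_zero ?_
    rw [Nat.cofinite_eq_atTop]
    exact squeeze_zero_norm (fun k => hun k j) ht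
  refine ⟨fun j => ∑' k, u k j, norm_tsum_triangular_tendsto hu0 hun ht, fun j => ?_, fun j => ?_,
    fun z S hS => ?_⟩
  · exact IsUltrametricDist.norm_tsum_le_of_forall_le_of_nonneg hM0 fun k => (hun k j).trans (hM k)
  -- The diagonal term $k=j$ is exactly $e_j$; every other nonzero term carries a positive power of
  -- $W$.
  · have h1 : HasSum (fun k => u k j - if k = j then e j else 0) (∑' k, u k j - e j) :=
      (hsum j).hasSum.sub (hasSum_ite_eq j (e j))
    rw [← h1.tsum_eq]
    refine IsUltrametricDist.norm_tsum_le_of_forall_le_of_nonneg (by positivity) fun k => ?_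
    rcases lt_trichotomy k j with hk | hk | hk
    · rw [hu0 k j hk, if_neg hk.ne]
      simp only [sub_zero, norm_zero]
      positivity
    · subst hk
      simp only [hu, if_true, Nat.sub_self, pow_zero, Nat.choose_self, Nat.cast_one, mul_one,
        sub_self, norm_zero]
      positivity
    · rw [if_neg hk.ne', sub_zero, hu, norm_mul, mul_comm, ← norm_emb (K := K) w]
      refine mul_le_mul ((hfac k j).trans ?_) (hM k) (norm_nonneg _) (norm_nonneg _)
      exact pow_le_of_le_one (norm_nonneg _) hW1 (by omega)
  · refine hasSum_triangular hu0 hun ht (norm_emb_le_one z) ?_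
    convert hS using 2 with k
    rw [emb_add, add_pow, Finset.mul_sum]
    refine Finset.sum_congr rfl fun j _ => ?_
    simp only [hu]
    ring

/-- At one centre the coefficients tend to zero, hence are bounded, but there are infinitely many
centres. Only $p^h$ distinct balls occur, and recentring from a representative $r<p^h$ preserves its
bound. -/
theorem HasBallExpansion.exists_bddExpansion {h : ℕ} {f : ℤ_[p] → K} {c : ℤ_[p] → ℕ → K}
    (hf : HasBallExpansion h f c) : ∃ M, BddExpansion h M f := by
  have hbd : ∀ a, ∃ M, ∀ k, ‖c a k‖ ≤ M := fun a => by
    obtain ⟨M, hM⟩ := (tendsto_zero_iff_norm_tendsto_zero.1 (hf a).1).bddAbove_range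
    exact ⟨M, fun k => hM ⟨k, rfl⟩⟩
  choose B hB using hbd
  have hB0 : ∀ a, 0 ≤ B a := fun a => (norm_nonneg _).trans (hB a 0)
  set M := ∑ r ∈ Finset.range (p ^ h), B (r : ℤ_[p]) with hM
  have key : ∀ a : ℤ_[p], ∃ e' : ℕ → K, Tendsto e' atTop (𝓝 0) ∧ (∀ k, ‖e' k‖ ≤ M) ∧
      ∀ z : ℤ_[p], HasSum (fun k => e' k * emb p K z ^ k) (f (a + (p : ℤ_[p]) ^ h * z)) := by
    intro a
    obtain ⟨r, hr, w, rfl⟩ := exists_eq_natCast_add a h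
    obtain ⟨e', h1, h2, -, h3⟩ := exists_recentre (hf r).1 (hB r) w
    refine ⟨e', h1, fun k => (h2 k).trans ?_, fun z => h3 z _ ?_⟩
    · exact Finset.single_le_sum (f := fun r : ℕ => B (r : ℤ_[p])) (fun i _ => hB0 _)
        (Finset.mem_range.2 hr)
    · have := (hf r).2 (z + w)
      rwa [show (r : ℤ_[p]) + (p : ℤ_[p]) ^ h * (z + w) = r + (p : ℤ_[p]) ^ h * w +
        (p : ℤ_[p]) ^ h * z by ring] at this
  choose c' h1 h2 h3 using key
  exact ⟨M, c', fun a => ⟨h1 a, h3 a⟩, h2⟩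

/-- Translation by $p^h w$ recentres each expansion by $w$, which changes the coefficients only by
multiples of $w$. -/
theorem BddExpansion.shift_sub {h : ℕ} {M : ℝ} {f : ℤ_[p] → K} (hf : BddExpansion h M f)
    (w : ℤ_[p]) :
    BddExpansion h (‖w‖ * M) (fun x => f (x + (p : ℤ_[p]) ^ h * w) - f x) := by
  obtain ⟨c, hc, hb⟩ := hf
  choose e' h1 h2 h3 h4 using fun a => exists_recentre (hc a).1 (hb a) w
  refine ⟨fun a k => e' a k - c a k, fun a => ⟨by simpa using (h1 a).sub (hc a).1, fun z => ?_⟩,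
    fun a k => h3 a k⟩
  have := h4 a z (f (a + (p : ℤ_[p]) ^ h * z + (p : ℤ_[p]) ^ h * w)) (by
    have := (hc a).2 (z + w)
    rwa [show a + (p : ℤ_[p]) ^ h * (z + w) = a + (p : ℤ_[p]) ^ h * z +
        (p : ℤ_[p]) ^ h * w by ring] at this)
  simpa [sub_mul] using this.sub ((hc a).2 z)

theorem BddExpansion.norm_sub_le {h n : ℕ} (hn : h ≤ n) {M : ℝ} {f : ℤ_[p] → K}
    (hf : BddExpansion h M f) (x w : ℤ_[p]) :
    ‖f (x + (p : ℤ_[p]) ^ n * w) - f x‖ ≤ (p : ℝ)⁻¹ ^ (n - h) * M := by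
  have h1 := (hf.shift_sub ((p : ℤ_[p]) ^ (n - h) * w)).norm_le x
  simp only [← mul_assoc, ← pow_add, Nat.add_sub_cancel' hn] at h1
  refine h1.trans (mul_le_mul_of_nonneg_right ?_ hf.nonneg)
  rw [norm_mul, norm_pow, PadicInt.norm_p]
  exact mul_le_of_le_one_right (by positivity) w.norm_le_one

/-- Modulo $p$ the operator $\Delta^{q}$, $q=p^{h+1}$, is translation by $q$ minus the identity,
because the interior binomial coefficients vanish. Translation by $q=p^h\cdot p$ differs from the
identity by a factor $p$ at level $h$. -/
theorem BddExpansion.fwdDiff_iter_prime_pow {h : ℕ} {M : ℝ} {f : ℤ_[p] → K}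
    (hf : BddExpansion h M f) :
    BddExpansion h ((p : ℝ)⁻¹ * M) ((fwdDiff 1)^[p ^ (h + 1)] f) := by
  have hp : p.Prime := Fact.out
  have hM := hf.nonneg
  set q := p ^ (h + 1) with hq
  have hpK : ∀ m : ℤ, (p : ℤ) ∣ m → ‖(m : K)‖ ≤ (p : ℝ)⁻¹ := by
    rintro _ ⟨m, rfl⟩
    have : ‖(p : K)‖ = (p : ℝ)⁻¹ := by
      rw [← emb_natCast (p := p), norm_emb, PadicInt.norm_p]
    push_cast
    rw [norm_mul, this]
    exact mul_le_of_le_one_right (by positivity) (IsUltrametricDist.norm_intCast_le_one K _)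
  obtain ⟨m, hm⟩ : ∃ m, q = m + 1 := Nat.exists_eq_succ_of_ne_zero (pow_pos hp.pos _).ne'
  have h1 : (fwdDiff 1)^[q] f = fun y => (∑ k ∈ Finset.range m,
      (((-1 : ℤ) ^ (q - (k + 1)) * q.choose (k + 1) : ℤ) : K) * f (y + (k + 1 : ℕ) • 1)) +
      ((((-1 : ℤ) ^ q + 1 : ℤ) : K) * f y + (f (y + (p : ℤ_[p]) ^ h * (p : ℤ_[p])) - f y)) := by
    funext y
    rw [fwdDiff_iter_eq_sum_shift]
    simp only [zsmul_eq_mul]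
    rw [Finset.sum_range_succ, hm, Finset.sum_range_succ', ← hm]
    have : y + q • (1 : ℤ_[p]) = y + (p : ℤ_[p]) ^ h * (p : ℤ_[p]) := by
      rw [nsmul_one, hq]; push_cast; ring
    rw [this]
    simp
    ring
  rw [h1]
  refine (BddExpansion.sum _ (by positivity) fun k hk => ?_).add (BddExpansion.add ?_ ?_)
  · refine ((hf.shift _).const_mul _).mono (mul_le_mul_of_nonneg_right (hpK _ ?_) hM)
    refine Dvd.dvd.mul_left (Int.natCast_dvd_natCast.2 ?_) _
    exact hp.dvd_choose_pow (by omega) (by have := Finset.mem_range.1 hk; omega)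
  -- The sign error $(-1)^q+1$ is $0$ for odd $p$ and $2=p$ for $p=2$.
  · refine (hf.const_mul _).mono (mul_le_mul_of_nonneg_right (hpK _ ?_) hM)
    rcases hp.eq_two_or_odd' with h2 | h2
    · rw [Even.neg_one_pow (by rw [hq, h2, pow_succ]; simp), h2]
      norm_num
    · rw [Odd.neg_one_pow (by rw [hq]; exact h2.pow)]
      simp
  · have := hf.shift_sub (p : ℤ_[p])
    rwa [PadicInt.norm_p] at this

/-- Exponential decay of the Mahler coefficients of a locally analytic function. -/
theorem BddExpansion.norm_fwdDiff_iter_le {h : ℕ} {M : ℝ} {f : ℤ_[p] → K}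
    (hf : BddExpansion h M f) (k : ℕ) (x : ℤ_[p]) :
    ‖(fwdDiff 1)^[k] f x‖ ≤ (p : ℝ)⁻¹ ^ (k / p ^ (h + 1)) * M := by
  have key : ∀ s : ℕ, BddExpansion h ((p : ℝ)⁻¹ ^ s * M) ((fwdDiff 1)^[p ^ (h + 1) * s] f) := by
    intro s
    induction s with
    | zero => simpa using hf
    | succ s ih =>
      rw [mul_add_one, Nat.add_comm (p ^ (h + 1) * s), Function.iterate_add_apply, pow_succ' _ s,
        mul_assoc]
      exact ih.fwdDiff_iter_prime_pow
  have h1 := ((key (k / p ^ (h + 1))).fwdDiff_iter (k % p ^ (h + 1))).norm_le x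
  rwa [← Function.iterate_add_apply, Nat.mod_add_div] at h1

end BallExpansions

/-! ### Binomial functions, Mahler series and injectivity of the transform. -/

section Binomial

variable {p : ℕ} [Fact p.Prime] {K : Type*} [NormedField K] [NormedAlgebra ℚ_[p] K]

variable (p K) in
theorem norm_natCast_eq_padic (n : ℕ) : ‖(n : K)‖ = ‖(n : ℚ_[p])‖ := by
  rw [← map_natCast (algebraMap ℚ_[p] K), norm_algebraMap']

theorem norm_natCast_padic_eq {n : ℕ} (hn : n ≠ 0) :
    ‖(n : ℚ_[p])‖ = (p : ℝ)⁻¹ ^ padicValNat p n := by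
  rw [Padic.norm_eq_zpow_neg_valuation (Nat.cast_ne_zero.2 hn), Padic.valuation_natCast,
    zpow_neg, zpow_natCast, inv_pow]

theorem norm_factorial_inv_le (m : ℕ) : ‖(m.factorial : ℚ_[p])‖⁻¹ ≤ (p : ℝ) ^ m := by
  have hp : p.Prime := Fact.out
  rw [norm_natCast_padic_eq m.factorial_ne_zero, inv_pow, inv_inv]
  refine pow_le_pow_right₀ (by exact_mod_cast hp.one_le) ?_
  have h1 := sub_one_mul_padicValNat_factorial (p := p) m
  have h2 : 1 ≤ p - 1 := by have := hp.two_le; omega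
  calc padicValNat p m.factorial ≤ (p - 1) * padicValNat p m.factorial :=
        Nat.le_mul_of_pos_left _ h2
    _ ≤ m := by omega

/-- A factor can exceed $1$ only if $p^h\mid r+1$; writing $r+1=p^hm$, it equals $|m|^{-1}$. -/
theorem prod_max_norm_div (h j : ℕ) :
    ∏ r ∈ Finset.range j, max 1 ‖(p : ℚ_[p]) ^ h / ((r + 1 : ℕ) : ℚ_[p])‖ =
      ‖((j / p ^ h).factorial : ℚ_[p])‖⁻¹ := by
  have hp : p.Prime := Fact.out
  have hp0 : (p : ℚ_[p]) ≠ 0 := Nat.cast_ne_zero.2 hp.ne_zero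
  induction j with
  | zero => simp
  | succ j ih =>
    rw [Finset.prod_range_succ, ih, Nat.succ_div]
    split_ifs with hd
    · obtain ⟨m, hm⟩ := hd
      have hm' : j / p ^ h + 1 = m := by
        have := Nat.succ_div (a := j) (b := p ^ h)
        rw [if_pos ⟨m, hm⟩, hm, Nat.mul_div_cancel_left _ (pow_pos hp.pos h)] at this
        exact this.symm
      rw [Nat.factorial_succ, hm', hm]
      push_cast
      have h1 : (p : ℚ_[p]) ^ h / ((p : ℚ_[p]) ^ h * m) = (m : ℚ_[p])⁻¹ := by
        field_simp
      have h2 : (1 : ℝ) ≤ ‖(m : ℚ_[p])‖⁻¹ := by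
        have hm0 : (m : ℚ_[p]) ≠ 0 := by
          rintro hm0
          simp [Nat.cast_eq_zero.1 hm0] at hm
        exact (one_le_inv₀ (norm_pos_iff.2 hm0)).2 (IsUltrametricDist.norm_natCast_le_one _ _)
      rw [h1, norm_inv, max_eq_right h2, norm_mul, mul_inv, mul_comm]
    · rw [add_zero, max_eq_left, mul_one]
      have h1 : ¬ ‖(((j + 1 : ℕ) : ℤ) : ℚ_[p])‖ ≤ (p : ℝ) ^ (-(h : ℤ)) := by
        rw [Padic.norm_int_le_pow_iff_dvd]
        exact_mod_cast hd
      rw [not_le, Int.cast_natCast] at h1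
      rw [norm_div, norm_pow, Padic.norm_p, inv_pow, ← zpow_natCast, ← zpow_neg]
      exact div_le_one_of_le₀ h1.le (norm_nonneg _)

variable [IsUltrametricDist K]

theorem norm_coeff_mul_le {P Q : Polynomial K} {A B : ℝ} (hP : ∀ i, ‖P.coeff i‖ ≤ A)
    (hQ : ∀ i, ‖Q.coeff i‖ ≤ B) (i : ℕ) : ‖(P * Q).coeff i‖ ≤ A * B := by
  have hA : 0 ≤ A := (norm_nonneg _).trans (hP 0)
  have hB : 0 ≤ B := (norm_nonneg _).trans (hQ 0)
  rw [Polynomial.coeff_mul]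
  refine IsUltrametricDist.norm_sum_le_of_forall_le_of_nonneg (by positivity) fun x _ => ?_
  rw [norm_mul]
  exact mul_le_mul (hP _) (hQ _) (norm_nonneg _) hA

/-- $\binom{p^hz-1}{j}=\prod_{r<j}\left(\frac{p^h}{r+1}z-1\right)$. The centre $-1$ is chosen so
that every constant term is the unit $-1$, and the Gauss norms of the factors multiply to the
product computed in `prod_max_norm_div`. -/
theorem exists_polynomial_choose_sub_one (h j : ℕ) : ∃ P : Polynomial K, P.natDegree ≤ j ∧
    (∀ i, ‖P.coeff i‖ ≤ ‖((j / p ^ h).factorial : ℚ_[p])‖⁻¹) ∧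
    ∀ z : ℤ_[p], emb p K (Ring.choose ((p : ℤ_[p]) ^ h * z - 1) j) = P.eval (emb p K z) := by
  have : CharZero K := charZero_of_injective_algebraMap (algebraMap ℚ_[p] K).injective
  rw [← prod_max_norm_div]
  induction j with
  | zero =>
    refine ⟨1, by simp, fun i => ?_, fun z => by simp⟩
    rw [Polynomial.coeff_one]
    split_ifs <;> simp
  | succ j ih =>
    obtain ⟨P, h1, h2, h3⟩ := ih
    have hj : ((j : K) + 1) ≠ 0 := by exact_mod_cast Nat.succ_ne_zero j
    refine ⟨P * (Polynomial.C ((p : K) ^ h / ((j + 1 : ℕ) : K)) * Polynomial.X - 1), ?_, ?_,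
      fun z => ?_⟩
    · refine Polynomial.natDegree_mul_le.trans (add_le_add h1 ?_)
      refine (Polynomial.natDegree_sub_le _ _).trans (max_le ?_ (by simp))
      exact (Polynomial.natDegree_C_mul_le _ _).trans Polynomial.natDegree_X_le
    · intro i
      rw [Finset.prod_range_succ]
      refine norm_coeff_mul_le h2 (fun i => ?_) i
      rw [Polynomial.coeff_sub, sub_eq_add_neg]
      refine (IsUltrametricDist.norm_add_le_max _ _).trans ?_
      rw [norm_neg, max_comm]
      refine max_le_max ?_ ?_
      · rw [Polynomial.coeff_one]
        split_ifs <;> simp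
      · rw [Polynomial.coeff_C_mul, norm_mul, Polynomial.coeff_X, norm_div, norm_div, norm_pow,
          norm_pow, norm_natCast_eq_padic p K, norm_natCast_eq_padic p K]
        refine mul_le_of_le_one_right (by positivity) ?_
        split_ifs <;> simp
    · rw [Polynomial.eval_mul, ← h3]
      have h4 := Ring.choose_smul_choose ((p : ℤ_[p]) ^ h * z - 1) (Nat.le_succ j)
      rw [Nat.succ_eq_add_one, Nat.add_sub_cancel_left, Ring.choose_one_right,
        Nat.choose_succ_self_right, nsmul_eq_mul] at h4
      have h5 := congrArg (emb p K) h4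
      have h6 : emb p K ((p : ℤ_[p]) ^ h * z - 1 - (j : ℤ_[p])) =
          (p : K) ^ h * emb p K z - (j + 1) := by
        simp [emb]
        ring
      rw [emb_mul, emb_mul, emb_natCast, h6] at h5
      push_cast at h5 ⊢
      simp only [Polynomial.eval_sub, Polynomial.eval_mul, Polynomial.eval_C, Polynomial.eval_X,
        Polynomial.eval_one]
      field_simp
      linear_combination h5

/-- Vandermonde's identity reduces an arbitrary centre to the centre $-1$, with coefficients
$\binom{a+1}{i}\in\mathbf{Z}_p$. -/
theorem exists_polynomial_choose (h k : ℕ) (a : ℤ_[p]) : ∃ P : Polynomial K, P.natDegree ≤ k ∧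
    (∀ i, ‖P.coeff i‖ ≤ (p : ℝ) ^ (k / p ^ h)) ∧
    ∀ z : ℤ_[p], emb p K (Ring.choose (a + (p : ℤ_[p]) ^ h * z) k) = P.eval (emb p K z) := by
  have hp : p.Prime := Fact.out
  choose P h1 h2 h3 using exists_polynomial_choose_sub_one (p := p) (K := K) h
  refine ⟨∑ ij ∈ Finset.HasAntidiagonal.antidiagonal k,
    Polynomial.C (emb p K (Ring.choose (a + 1) ij.1)) * P ij.2, ?_, fun i => ?_, fun z => ?_⟩
  · refine Polynomial.natDegree_sum_le_of_forall_le _ _ fun ij hij => ?_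
    have := Finset.HasAntidiagonal.antidiagonal.snd_le hij
    exact (Polynomial.natDegree_C_mul_le _ _).trans ((h1 _).trans this)
  · rw [Polynomial.finsetSum_coeff]
    refine IsUltrametricDist.norm_sum_le_of_forall_le_of_nonneg (by positivity) fun ij hij => ?_
    rw [Polynomial.coeff_C_mul, norm_mul]
    refine (mul_le_of_le_one_left (norm_nonneg _) (norm_emb_le_one _)).trans ?_
    refine (h2 _ _).trans ((norm_factorial_inv_le _).trans ?_)
    exact pow_le_pow_right₀ (by exact_mod_cast hp.one_le)
      (Nat.div_le_div_right (Finset.HasAntidiagonal.antidiagonal.snd_le hij))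
  · rw [show a + (p : ℤ_[p]) ^ h * z = (a + 1) + ((p : ℤ_[p]) ^ h * z - 1) by ring,
      Ring.add_choose_eq _ (Commute.all _ _), emb_sum, Polynomial.eval_finsetSum]
    simp [emb_mul, h3]

theorem bddExpansion_choose (h k : ℕ) :
    BddExpansion h ((p : ℝ) ^ (k / p ^ h)) fun x : ℤ_[p] => emb p K (Ring.choose x k) := by
  choose P h1 h2 h3 using exists_polynomial_choose (p := p) (K := K) h k
  refine ⟨fun a j => (P a).coeff j, fun a => ⟨?_, fun z => ?_⟩, fun a j => h2 a j⟩
  · refine tendsto_const_nhds.congr' ?_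
    filter_upwards [eventually_gt_atTop k] with j hj
    exact (Polynomial.coeff_eq_zero_of_natDegree_lt ((h1 a).trans_lt hj)).symm
  · change HasSum (fun j => (P a).coeff j * emb p K z ^ j)
      (emb p K (Ring.choose (a + (p : ℤ_[p]) ^ h * z) k))
    rw [h3, Polynomial.eval_eq_sum_range]
    refine hasSum_sum_of_ne_finset_zero fun j hj => ?_
    rw [Polynomial.coeff_eq_zero_of_natDegree_lt (by simpa [Nat.lt_succ_iff] using hj), zero_mul]

variable [CompleteSpace K]

theorem BddExpansion.continuous {h : ℕ} {M : ℝ} {f : ℤ_[p] → K} (hf : BddExpansion h M f) :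
    Continuous f := by
  have hp : p.Prime := Fact.out
  rw [Metric.continuous_iff]
  intro x δ hδ
  have h0 : Tendsto (fun n : ℕ => (p : ℝ)⁻¹ ^ n * M) atTop (𝓝 0) := by
    simpa using (tendsto_pow_atTop_nhds_zero_of_lt_one (by positivity)
      (inv_lt_one_of_one_lt₀ (by exact_mod_cast hp.one_lt))).mul_const M
  obtain ⟨n, hn⟩ := (h0.eventually (gt_mem_nhds hδ)).exists
  refine ⟨(p : ℝ) ^ (-((h + n : ℕ) : ℤ)), zpow_pos (by exact_mod_cast hp.pos) _, fun y hy => ?_⟩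
  rw [dist_eq_norm] at hy ⊢
  obtain ⟨w, hw⟩ := Ideal.mem_span_singleton.1
    ((PadicInt.norm_le_pow_iff_mem_span_pow _ _).1 hy.le)
  have := hf.norm_sub_le (Nat.le_add_right h n) x w
  rw [← hw, add_sub_cancel, Nat.add_sub_cancel_left] at this
  exact this.trans_lt hn

/-- Mahler's theorem for locally analytic functions with values in `K`. -/
theorem BddExpansion.hasSum_mahler {h : ℕ} {M : ℝ} {f : ℤ_[p] → K} (hf : BddExpansion h M f)
    (x : ℤ_[p]) :
    HasSum (fun k => (fwdDiff 1)^[k] f 0 * emb p K (Ring.choose x k)) (f x) := by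
  -- Mahler's theorem for continuous functions requires a bounded $\mathbf{Z}_p$-action on the
  -- target; it is supplied by the embedding.
  let _ : Module ℤ_[p] K :=
    Module.compHom K ((algebraMap ℚ_[p] K).comp (PadicInt.Coe.ringHom (p := p)))
  have hsmul : ∀ (r : ℤ_[p]) (y : K), r • y = emb p K r * y := fun r y => rfl
  have : IsBoundedSMul ℤ_[p] K := IsBoundedSMul.of_norm_smul_le fun r y => by
    rw [hsmul, norm_mul, norm_emb]
  have h1 := PadicInt.hasSum_mahler (⟨f, hf.continuous⟩ : C(ℤ_[p], K))
  have h2 := ContinuousMap.hasSum_apply h1 x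
  simpa [PadicInt.mahlerTerm_apply, hsmul, mul_comm, mahler_apply] using h2

/-- The Mahler series of a function analytic on the balls of radius `p^(-h)` converges to it as a
series of functions analytic on the balls of radius `p^(-h-2)`. -/
theorem BddExpansion.mahler_tail {h : ℕ} {M : ℝ} {f : ℤ_[p] → K} (hf : BddExpansion h M f)
    (N : ℕ) : BddExpansion (h + 2) ((p : ℝ)⁻¹ ^ (N / p ^ (h + 1) / 2) * M) fun x =>
      f x - ∑ k ∈ Finset.range N, (fwdDiff 1)^[k] f 0 * emb p K (Ring.choose x k) := by
  have hp : p.Prime := Fact.out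
  have hp1 : (1 : ℝ) ≤ p := by exact_mod_cast hp.one_le
  have hp0 : (0 : ℝ) < p := by exact_mod_cast hp.pos
  have hM := hf.nonneg
  choose P h1 h2 h3 using fun k a => exists_polynomial_choose (p := p) (K := K) (h + 2) k a
  set m : ℕ → K := fun k => (fwdDiff 1)^[k] f 0 with hm
  set T : ℕ → ℝ := fun k => (p : ℝ)⁻¹ ^ (k / p ^ (h + 1) / 2) * M with hT
  have hT0 : ∀ k, 0 ≤ T k := fun k => by positivity
  have hTanti : ∀ {k l}, k ≤ l → T l ≤ T k := fun {k l} hkl => by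
    refine mul_le_mul_of_nonneg_right ?_ hM
    exact pow_le_pow_of_le_one (by positivity) (inv_le_one_of_one_le₀ hp1)
      (Nat.div_le_div_right (Nat.div_le_div_right hkl))
  have hTlim : Tendsto T atTop (𝓝 0) := by
    have h5 : Tendsto (fun k : ℕ => k / p ^ (h + 1) / 2) atTop atTop :=
      (Nat.tendsto_div_const_atTop two_ne_zero).comp
        (Nat.tendsto_div_const_atTop (pow_pos hp.pos _).ne')
    simpa [hT] using ((tendsto_pow_atTop_nhds_zero_of_lt_one (by positivity)
      (inv_lt_one_of_one_lt₀ (by exact_mod_cast hp.one_lt))).comp h5).mul_const M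
  have hbound : ∀ a k j, ‖m k * (P k a).coeff j‖ ≤ T k := by
    intro a k j
    rw [norm_mul]
    refine (mul_le_mul (hf.norm_fwdDiff_iter_le k 0) (h2 k a j) (norm_nonneg _)
      (by positivity)).trans ?_
    rw [mul_right_comm]
    refine mul_le_mul_of_nonneg_right ?_ hM
    have h4 : k / p ^ (h + 2) = k / p ^ (h + 1) / p := by
      rw [Nat.div_div_eq_div_mul, ← pow_succ]
    set s := k / p ^ (h + 1)
    -- At level $h+2$ the binomial function grows like $p^{\lfloor s/p\rfloor}$ while the Mahler
    -- coefficient decays like $p^{-s}$; since $p\ge2$, a decay of $p^{-\lfloor s/2\rfloor}$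
    -- remains.
    have h5 : s / p + s / 2 ≤ s := by
      have : s / p ≤ s / 2 := Nat.div_le_div_left hp.two_le two_pos
      omega
    rw [h4]
    calc (p : ℝ)⁻¹ ^ s * (p : ℝ) ^ (s / p)
        ≤ (p : ℝ)⁻¹ ^ (s / p + s / 2) * (p : ℝ) ^ (s / p) := by
          refine mul_le_mul_of_nonneg_right ?_ (by positivity)
          exact pow_le_pow_of_le_one (by positivity) (inv_le_one_of_one_le₀ hp1) h5
      _ = (p : ℝ)⁻¹ ^ (s / 2) := by
          rw [pow_add, mul_right_comm, ← mul_pow, inv_mul_cancel₀ hp0.ne', one_pow, one_mul]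
  -- Deleting the terms $k<N$ leaves a triangular array bounded uniformly by `T N`.
  set u : ℤ_[p] → ℕ → ℕ → K := fun a k j => if k < N then 0 else m k * (P k a).coeff j with hu
  have hu0 : ∀ a k j, k < j → u a k j = 0 := fun a k j hkj => by
    simp only [hu]
    split_ifs
    · rfl
    · rw [Polynomial.coeff_eq_zero_of_natDegree_lt ((h1 k a).trans_lt hkj), mul_zero]
  have hun : ∀ a k j, ‖u a k j‖ ≤ T k := fun a k j => by
    simp only [hu]
    split_ifs
    · simpa using hT0 k
    · exact hbound a k j
  have hun' : ∀ a k j, ‖u a k j‖ ≤ T N := fun a k j => by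
    simp only [hu]
    split_ifs with hk
    · simpa using hT0 N
    · exact (hbound a k j).trans (hTanti (not_lt.1 hk))
  refine ⟨fun a j => ∑' k, u a k j, fun a => ⟨norm_tsum_triangular_tendsto (hu0 a) (hun a) hTlim,
    fun z => ?_⟩, fun a j =>
      IsUltrametricDist.norm_tsum_le_of_forall_le_of_nonneg (hT0 N) fun k => hun' a k j⟩
  refine hasSum_triangular (hu0 a) (hun a) hTlim (norm_emb_le_one z) ?_
  set x := a + (p : ℤ_[p]) ^ (h + 2) * z with hx
  have h4 := (hf.hasSum_mahler x).sub (hasSum_sum_of_ne_finset_zero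
    (s := Finset.range N)
    (f := fun k => if k < N then m k * emb p K (Ring.choose x k) else 0)
    (fun k hk => if_neg (by simpa using hk)))
  have h6 : ∑ k ∈ Finset.range N, (if k < N then m k * emb p K (Ring.choose x k) else 0) =
      ∑ k ∈ Finset.range N, m k * emb p K (Ring.choose x k) :=
    Finset.sum_congr rfl fun k hk => if_pos (Finset.mem_range.1 hk)
  rw [h6] at h4
  have h7 : ∀ k, ∑ j ∈ Finset.range (k + 1), u a k j * emb p K z ^ j =
      m k * emb p K (Ring.choose x k) -
        if k < N then m k * emb p K (Ring.choose x k) else 0 := by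
    intro k
    simp only [hu]
    split_ifs with hk
    · simp [hm]
    · rw [hx, h3, Polynomial.eval_eq_sum_range' (Nat.lt_succ_of_le (h1 k a)), Finset.mul_sum,
        sub_zero]
      exact Finset.sum_congr rfl fun j _ => mul_assoc _ _ _
  simp only [h7]
  exact h4

/-- A distribution is the sum of its values on the terms of the Mahler series. -/
theorem Distribution.tendsto_mahler (ν : Distribution p K) (f : LocAnalytic p K) {h : ℕ} {M : ℝ}
    (hf : BddExpansion h M (f : ℤ_[p] → K)) :
    Tendsto (fun N => ∑ k ∈ Finset.range N, (fwdDiff 1)^[k] (f : ℤ_[p] → K) 0 *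
      ν.transform.coeff k) atTop (𝓝 (ν.toLinearMap f)) := by
  have hp : p.Prime := Fact.out
  obtain ⟨B, hB⟩ := ν.bounded (h + 2)
  rw [tendsto_iff_norm_sub_tendsto_zero]
  have h5 : Tendsto (fun k : ℕ => k / p ^ (h + 1) / 2) atTop atTop :=
    (Nat.tendsto_div_const_atTop two_ne_zero).comp
      (Nat.tendsto_div_const_atTop (pow_pos hp.pos _).ne')
  have hlim : Tendsto (fun N : ℕ => B * ((p : ℝ)⁻¹ ^ (N / p ^ (h + 1) / 2) * M)) atTop (𝓝 0) := by
    simpa using (((tendsto_pow_atTop_nhds_zero_of_lt_one (by positivity)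
      (inv_lt_one_of_one_lt₀ (by exact_mod_cast hp.one_lt))).comp h5).mul_const M).const_mul B
  refine squeeze_zero (fun _ => norm_nonneg _) (fun N => ?_) hlim
  obtain ⟨c, hc, hb⟩ := hf.mahler_tail N
  set g : LocAnalytic p K :=
    f - ∑ k ∈ Finset.range N, (fwdDiff 1)^[k] (f : ℤ_[p] → K) 0 • chooseFun K k with hg
  have hgf : (g : ℤ_[p] → K) = fun x => (f : ℤ_[p] → K) x - ∑ k ∈ Finset.range N,
      (fwdDiff 1)^[k] (f : ℤ_[p] → K) 0 * emb p K (Ring.choose x k) := by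
    funext x
    simp [hg, chooseFun]
  have h6 := hB g c _ (by rw [hgf]; exact hc) hb
  have h7 : ν.toLinearMap g = ν.toLinearMap f - ∑ k ∈ Finset.range N,
      (fwdDiff 1)^[k] (f : ℤ_[p] → K) 0 * ν.transform.coeff k := by
    simp [hg, Distribution.transform]
  rwa [h7, norm_sub_rev] at h6

theorem LocAnalytic.exists_bddExpansion (f : LocAnalytic p K) :
    ∃ h M, BddExpansion h M (f : ℤ_[p] → K) := by
  obtain ⟨h, c, hc⟩ := f.2
  exact ⟨h, hc.exists_bddExpansion⟩

theorem Distribution.transform_injective :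
    Function.Injective (Distribution.transform : Distribution p K → PowerSeries K) := by
  intro ν₁ ν₂ h12
  have : ν₁.toLinearMap = ν₂.toLinearMap := by
    ext f
    obtain ⟨h, M, hf⟩ := LocAnalytic.exists_bddExpansion f
    refine tendsto_nhds_unique (ν₁.tendsto_mahler f hf) ?_
    rw [h12]
    exact ν₂.tendsto_mahler f hf
  cases ν₁
  cases ν₂
  simpa using this

end Binomial

/-! ### Growth of order $o(\log)$ and determination by values on balls. -/

section LogGrowth

variable {p : ℕ} [Fact p.Prime]

theorem norm_coeff_log {i : ℕ} (hi : i ≠ 0) :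
    ‖(PowerSeries.log ℚ_[p]).coeff i‖ = (p : ℝ) ^ padicValNat p i := by
  rw [PowerSeries.coeff_log, if_neg hi, map_div₀, norm_div, map_natCast,
    norm_natCast_padic_eq hi]
  simp

theorem hasGaussNorm_log {ρ : ℝ} (h0 : 0 ≤ ρ) (h1 : ρ < 1) :
    PowerSeries.HasGaussNorm (fun x : ℚ_[p] => ‖x‖) ρ (PowerSeries.log ℚ_[p]) := by
  obtain ⟨B, hB⟩ := (tendsto_self_mul_const_pow_of_lt_one h0 h1).bddAbove_range
  refine ⟨B, ?_⟩
  rintro _ ⟨i, rfl⟩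
  refine le_trans ?_ (hB ⟨i, rfl⟩)
  refine mul_le_mul_of_nonneg_right ?_ (pow_nonneg h0 i)
  rcases eq_or_ne i 0 with rfl | hi
  · simp
  · simp only [norm_coeff_log hi]
    exact_mod_cast Nat.le_of_dvd (Nat.pos_of_ne_zero hi) pow_padicValNat_dvd

theorem le_gaussNorm_log {ρ : ℝ} (h0 : 0 ≤ ρ) (h1 : ρ < 1) (l : ℕ) :
    (p : ℝ) ^ l * ρ ^ p ^ l ≤
      PowerSeries.gaussNorm (fun x : ℚ_[p] => ‖x‖) ρ (PowerSeries.log ℚ_[p]) := by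
  have hp : p.Prime := Fact.out
  have := PowerSeries.le_gaussNorm _ _ _ (hasGaussNorm_log (p := p) h0 h1) (p ^ l)
  rwa [norm_coeff_log (pow_pos hp.pos l).ne', padicValNat.prime_pow] at this

/-- At this radius the terms with $v\le n$ are at most $p^n$. For $v=n+e+1$, $\rho^i\le
p^{-p^{e+1}}\le p^{-(e+1)}$ absorbs the excess of $p^v$ over $p^n$. -/
theorem gaussNorm_log_le {ρ : ℝ} (h0 : 0 ≤ ρ) {n : ℕ} (hρ : ρ ^ p ^ n = (p : ℝ)⁻¹) :
    PowerSeries.gaussNorm (fun x : ℚ_[p] => ‖x‖) ρ (PowerSeries.log ℚ_[p]) ≤ (p : ℝ) ^ n := by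
  have hp : p.Prime := Fact.out
  have hp1 : (1 : ℝ) ≤ p := by exact_mod_cast hp.one_le
  have h1 : ρ ≤ 1 := by
    by_contra h
    have := one_lt_pow₀ (not_le.1 h) (pow_pos hp.pos n).ne'
    rw [hρ] at this
    exact absurd (inv_le_one_of_one_le₀ hp1) (not_le.2 this)
  rw [PowerSeries.gaussNorm_eq]
  refine ciSup_le fun i => ?_
  rcases eq_or_ne i 0 with rfl | hi
  · simp
  rw [norm_coeff_log hi]
  set v := padicValNat p i with hv
  rcases le_or_gt v n with hvn | hvn
  · calc (p : ℝ) ^ v * ρ ^ i ≤ (p : ℝ) ^ v * 1 := by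
          gcongr
          exact pow_le_one₀ h0 h1
      _ ≤ (p : ℝ) ^ n := by
          rw [mul_one]
          exact pow_le_pow_right₀ hp1 hvn
  · obtain ⟨e, he⟩ := Nat.exists_eq_add_of_lt hvn
    have h2 : ρ ^ i ≤ (p : ℝ)⁻¹ ^ (e + 1) := by
      calc ρ ^ i ≤ ρ ^ p ^ v :=
            pow_le_pow_of_le_one h0 h1
              (Nat.le_of_dvd (Nat.pos_of_ne_zero hi) pow_padicValNat_dvd)
        _ = (p : ℝ)⁻¹ ^ p ^ (e + 1) := by
            rw [show v = n + (e + 1) by omega, pow_add, pow_mul, hρ]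
        _ ≤ (p : ℝ)⁻¹ ^ (e + 1) :=
            pow_le_pow_of_le_one (by positivity) (inv_le_one_of_one_le₀ hp1)
              (Nat.lt_pow_self hp.one_lt).le
    calc (p : ℝ) ^ v * ρ ^ i ≤ (p : ℝ) ^ v * (p : ℝ)⁻¹ ^ (e + 1) := by gcongr
      _ = (p : ℝ) ^ n := by
        rw [show v = n + (e + 1) by omega, pow_add, mul_assoc, ← mul_pow,
          mul_inv_cancel₀ (by positivity), one_pow, mul_one]

theorem eventually_le_gaussNorm_log (B : ℝ) : ∀ᶠ ρ : ℝ in 𝓝[<] 1,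
    B ≤ PowerSeries.gaussNorm (fun x : ℚ_[p] => ‖x‖) ρ (PowerSeries.log ℚ_[p]) := by
  have hp : p.Prime := Fact.out
  obtain ⟨l, hl⟩ := pow_unbounded_of_one_lt B (show (1 : ℝ) < p by exact_mod_cast hp.one_lt)
  have h1 : Tendsto (fun ρ : ℝ => (p : ℝ) ^ l * ρ ^ p ^ l) (𝓝[<] 1) (𝓝 ((p : ℝ) ^ l)) := by
    have : Continuous fun ρ : ℝ => (p : ℝ) ^ l * ρ ^ p ^ l := by fun_prop
    simpa using (this.tendsto 1).mono_left nhdsWithin_le_nhds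
  filter_upwards [h1.eventually (lt_mem_nhds hl), self_mem_nhdsWithin,
    nhdsWithin_le_nhds (lt_mem_nhds (zero_lt_one' ℝ))] with ρ h2 h3 h4
  exact h2.le.trans (le_gaussNorm_log h4.le h3 l)

/-- For $p^l\le k<p^{l+1}$ the $k$-th term is at most $Ct^{l+1}\rho^{p^l}$, to be compared with the
term $p^l\rho^{p^l}$ of the logarithm; the ratio tends to $0$ as $l$ grows. The finitely many small
$k$ are absorbed because $\|\log\|_\rho$ is unbounded. -/
theorem isLittleOLog_of_norm_coeff_le {K : Type*} [NormedField K] {F : PowerSeries K} {C t : ℝ}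
    (ht0 : 0 ≤ t) (htp : t < p) (hF : ∀ h k : ℕ, k < p ^ h → ‖F.coeff k‖ ≤ C * t ^ h) :
    IsLittleOLog p F := by
  have hp : p.Prime := Fact.out
  have hp0 : (0 : ℝ) < p := by exact_mod_cast hp.pos
  have hC : 0 ≤ C := by simpa using (norm_nonneg _).trans (hF 0 0 (by simp))
  intro δ hδ
  have h1 : Tendsto (fun l : ℕ => C * t * (t / p) ^ l) atTop (𝓝 0) := by
    simpa using (tendsto_pow_atTop_nhds_zero_of_lt_one (by positivity)
      ((div_lt_one hp0).2 htp)).const_mul (C * t)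
  obtain ⟨L, hL⟩ := eventually_atTop.1 (h1.eventually (gt_mem_nhds hδ))
  filter_upwards [eventually_le_gaussNorm_log (p := p) (C * t ^ L / δ), self_mem_nhdsWithin,
    nhdsWithin_le_nhds (lt_mem_nhds (zero_lt_one' ℝ))] with ρ h2 h3 h4 k
  have h3' : ρ < 1 := h3
  rcases lt_or_ge k (p ^ L) with hk | hk
  · refine (mul_le_of_le_one_right (norm_nonneg _) (pow_le_one₀ h4.le h3'.le)).trans ?_
    refine (hF L k hk).trans ?_
    rwa [div_le_iff₀' hδ] at h2
  · have hk0 : k ≠ 0 := by have := pow_pos hp.pos L; omega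
    have hl : L ≤ Nat.log p k := (Nat.le_log_iff_pow_le hp.one_lt hk0).2 hk
    have hl1 : p ^ Nat.log p k ≤ k := Nat.pow_log_le_self p hk0
    have hl2 : k < p ^ (Nat.log p k + 1) := Nat.lt_pow_succ_log_self hp.one_lt k
    set l := Nat.log p k
    have h5 : C * t ^ (l + 1) ≤ δ * (p : ℝ) ^ l := by
      have := (hL l hl).le
      rw [div_pow, mul_div_assoc', div_le_iff₀ (by positivity)] at this
      calc C * t ^ (l + 1) = C * t * t ^ l := by ring
        _ ≤ _ := this
    calc ‖F.coeff k‖ * ρ ^ k ≤ δ * (p : ℝ) ^ l * ρ ^ p ^ l :=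
          mul_le_mul ((hF _ _ hl2).trans h5) (pow_le_pow_of_le_one h4.le h3'.le hl1)
            (pow_nonneg h4.le _) (by positivity)
      _ = δ * ((p : ℝ) ^ l * ρ ^ p ^ l) := by ring
      _ ≤ _ := mul_le_mul_of_nonneg_left (le_gaussNorm_log h4.le h3' l) hδ.le

variable {K : Type*} [NormedField K] [NormedAlgebra ℚ_[p] K]

theorem natCast_add_mem_ball_iff {n b r : ℕ} (hb : b < p ^ n) (hr : r < p ^ n) (w : ℤ_[p]) :
    (r : ℤ_[p]) + (p : ℤ_[p]) ^ n * w ∈ ball (b : ℤ_[p]) n ↔ b = r := by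
  constructor
  · rintro ⟨z, hz⟩
    have h1 : ((b : ℤ) - r : ℤ) = 0 := by
      have h2 : (((b : ℤ) - r : ℤ) : ℤ_[p]) ∈ Ideal.span {(p : ℤ_[p]) ^ n} := by
        rw [Ideal.mem_span_singleton]
        refine ⟨w - z, ?_⟩
        push_cast
        linear_combination -hz
      rw [← PadicInt.norm_le_pow_iff_mem_span_pow, PadicInt.norm_int_le_pow_iff_dvd] at h2
      refine Int.eq_zero_of_abs_lt_dvd h2 ?_
      have h3 : ((p ^ n : ℕ) : ℤ) = (p : ℤ) ^ n := by push_cast; rfl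
      rw [← h3, abs_lt]
      omega
    omega
  · rintro rfl
    exact ⟨w, rfl⟩

/-- The function constant on the balls of radius `p^(-n)`, with the values of `g` at the integers
`0 ≤ b < p^n`. -/
noncomputable def stepFun (g : ℤ_[p] → K) (n : ℕ) : LocAnalytic p K :=
  ∑ b ∈ Finset.range (p ^ n), g b • ballFun K (b : ℤ_[p]) n

theorem stepFun_apply (g : ℤ_[p] → K) {n r : ℕ} (hr : r < p ^ n) (w : ℤ_[p]) :
    (stepFun g n : ℤ_[p] → K) (r + (p : ℤ_[p]) ^ n * w) = g r := by
  classical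
  simp only [stepFun, ballFun, Submodule.coe_sum, Submodule.coe_smul, Finset.sum_apply,
    Pi.smul_apply, smul_eq_mul]
  rw [Finset.sum_eq_single_of_mem r (Finset.mem_range.2 hr)]
  · rw [Set.indicator_of_mem ((natCast_add_mem_ball_iff hr hr w).2 rfl), mul_one]
  · intro b hb hbr
    rw [Set.indicator_of_notMem, mul_zero]
    exact fun h => hbr ((natCast_add_mem_ball_iff (Finset.mem_range.1 hb) hr w).1 h)

variable [IsUltrametricDist K] [CompleteSpace K]

/-- The norm of a distribution of order `o(log)` on the functions analytic on the balls of radius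
`p^(-n)` is `o(p^n)`. -/
theorem Distribution.IsLittleOLog.eventually_norm_le {ν : Distribution p K}
    (hν : ν.IsLittleOLog) {δ : ℝ} (hδ : 0 < δ) :
    ∀ᶠ n : ℕ in atTop, ∀ (f : LocAnalytic p K) (M : ℝ), BddExpansion n M (f : ℤ_[p] → K) →
      ‖ν.toLinearMap f‖ ≤ δ * (p : ℝ) ^ n * M := by
  have hp : p.Prime := Fact.out
  have hp0 : (0 : ℝ) < p := by exact_mod_cast hp.pos
  have hp1 : (1 : ℝ) < p := by exact_mod_cast hp.one_lt
  have hinv : (p : ℝ)⁻¹ < 1 := inv_lt_one_of_one_lt₀ hp1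
  -- The radius with $\rho_n^{p^{n+1}}=1/p$, so that $\rho_n^i$ matches the decay $p^{-\lfloor
  -- i/p^{n+1}\rfloor}$ of Mahler coefficients at level $n$.
  set ρ : ℕ → ℝ := fun n => (p : ℝ)⁻¹ ^ (((p : ℝ)⁻¹) ^ (n + 1)) with hρ
  have hρpos : ∀ n, 0 < ρ n := fun n => Real.rpow_pos_of_pos (by positivity) _
  have hρlt : ∀ n, ρ n < 1 := fun n =>
    Real.rpow_lt_one (by positivity) hinv (by positivity)
  have hρpow : ∀ n, ρ n ^ p ^ (n + 1) = (p : ℝ)⁻¹ := fun n => by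
    rw [← Real.rpow_natCast, hρ, ← Real.rpow_mul (by positivity)]
    push_cast
    rw [← mul_pow, inv_mul_cancel₀ hp0.ne', one_pow, Real.rpow_one]
  have hlim : Tendsto ρ atTop (𝓝[<] 1) := by
    refine tendsto_nhdsWithin_iff.2 ⟨?_, Eventually.of_forall hρlt⟩
    have h1 : Tendsto (fun n : ℕ => ((p : ℝ)⁻¹) ^ (n + 1)) atTop (𝓝 0) :=
      (tendsto_pow_atTop_nhds_zero_of_lt_one (by positivity) hinv).comp (tendsto_add_atTop_nat 1)
    have h2 := (Real.continuousAt_const_rpow (a := (p : ℝ)⁻¹) (b := 0) (by positivity)).tendsto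
    rw [Real.rpow_zero] at h2
    exact h2.comp h1
  -- One factor $p$ is lost to $\|\log\|_{\rho_n}\le p^{n+1}$ and another to the floor in the
  -- exponent, hence $\delta/p^2$.
  filter_upwards [hlim.eventually (hν (δ / (p : ℝ) ^ 2) (by positivity))] with n hn f M hf
  have hM := hf.nonneg
  have hF : ∀ i, ‖ν.transform.coeff i‖ * ρ n ^ i ≤ δ / (p : ℝ) ^ 2 * (p : ℝ) ^ (n + 1) :=
    fun i => (hn i).trans (mul_le_mul_of_nonneg_left
      (gaussNorm_log_le (hρpos n).le (hρpow n)) (by positivity))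
  refine le_of_tendsto (ν.tendsto_mahler f hf).norm (Eventually.of_forall fun N => ?_)
  refine IsUltrametricDist.norm_sum_le_of_forall_le_of_nonneg (by positivity) fun i _ => ?_
  have h1 : (p : ℝ)⁻¹ ^ (i / p ^ (n + 1)) ≤ p * ρ n ^ i := by
    have h2 : ρ n ^ (p ^ (n + 1) * (i / p ^ (n + 1) + 1)) ≤ ρ n ^ i :=
      pow_le_pow_of_le_one (hρpos n).le (hρlt n).le
        (Nat.lt_mul_div_succ i (pow_pos hp.pos _)).le
    rw [pow_mul, hρpow, pow_succ] at h2
    calc (p : ℝ)⁻¹ ^ (i / p ^ (n + 1)) = p * ((p : ℝ)⁻¹ ^ (i / p ^ (n + 1)) * (p : ℝ)⁻¹) := by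
          field_simp
      _ ≤ _ := by gcongr
  rw [norm_mul]
  calc _ ≤ (p * ρ n ^ i * M) * ‖ν.transform.coeff i‖ := by
        gcongr
        exact (hf.norm_fwdDiff_iter_le i 0).trans (mul_le_mul_of_nonneg_right h1 hM)
    _ = p * M * (‖ν.transform.coeff i‖ * ρ n ^ i) := by ring
    _ ≤ p * M * (δ / (p : ℝ) ^ 2 * (p : ℝ) ^ (n + 1)) := by
        exact mul_le_mul_of_nonneg_left (hF i) (by positivity)
    _ = δ * (p : ℝ) ^ n * M := by
        field_simp
        ring

/-- Shrinking the radius from $p^{-h}$ to $p^{-n}$ multiplies the $k$-th coefficient by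
$p^{(n-h)k}$, so only the constant term needs the step function; there the error is the variation of
$g$ on one ball. -/
theorem BddExpansion.sub_stepFun {h n : ℕ} (hn : h ≤ n) {M : ℝ} {g : ℤ_[p] → K}
    (hg : BddExpansion h M g) :
    BddExpansion n ((p : ℝ)⁻¹ ^ (n - h) * M) fun x => g x - (stepFun g n : ℤ_[p] → K) x := by
  have hp : p.Prime := Fact.out
  have hM := hg.nonneg
  have hpe : ‖emb p K ((p : ℤ_[p]) ^ (n - h))‖ = (p : ℝ)⁻¹ ^ (n - h) := by
    rw [norm_emb, norm_pow, PadicInt.norm_p]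
  have hpe1 : ‖emb p K ((p : ℤ_[p]) ^ (n - h))‖ ≤ 1 := norm_emb_le_one _
  have hg' := hg
  obtain ⟨c, hc, hb⟩ := hg
  have hc' := hc.mono hn
  set d : ℤ_[p] → ℕ → K := fun a k => c a k * emb p K ((p : ℤ_[p]) ^ (n - h)) ^ k with hd
  have hstep : ∀ a z, (stepFun g n : ℤ_[p] → K) (a + (p : ℤ_[p]) ^ n * z) =
      (stepFun g n : ℤ_[p] → K) a := fun a z => by
    obtain ⟨r, hr, w, rfl⟩ := exists_eq_natCast_add a n
    rw [add_assoc, ← mul_add, stepFun_apply g hr, stepFun_apply g hr]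
  have hd0 : ∀ a, d a 0 = g a := fun a => by
    have h1 := (hc' a).2 0
    have h2 : HasSum (fun k => d a k * emb p K 0 ^ k) (d a 0 * emb p K 0 ^ 0) :=
      hasSum_single 0 fun k hk => by simp [hk]
    have := h2.unique h1
    simpa using this
  refine ⟨fun a k => d a k - if k = 0 then (stepFun g n : ℤ_[p] → K) a else 0,
    fun a => ⟨?_, fun z => ?_⟩, fun a k => ?_⟩
  · refine (hc' a).1.congr' ?_
    filter_upwards [eventually_gt_atTop 0] with k hk
    rw [if_neg hk.ne', sub_zero]
  · have h1 := ((hc' a).2 z).sub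
      (hasSum_ite_eq 0 ((stepFun g n : ℤ_[p] → K) (a + (p : ℤ_[p]) ^ n * z)))
    have h2 : (fun k => (d a k - if k = 0 then (stepFun g n : ℤ_[p] → K) a else 0) *
        emb p K z ^ k) = fun k => d a k * emb p K z ^ k -
          if k = 0 then (stepFun g n : ℤ_[p] → K) (a + (p : ℤ_[p]) ^ n * z) else 0 := by
      funext k
      rw [hstep]
      split_ifs with hk
      · simp [hk]
      · simp
    rw [h2]
    exact h1
  · dsimp only
    split_ifs with hk
    · rw [hk, hd0]
      obtain ⟨r, hr, w, rfl⟩ := exists_eq_natCast_add a n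
      rw [stepFun_apply g hr]
      exact hg'.norm_sub_le hn _ _
    · rw [sub_zero, hd, norm_mul, norm_pow, mul_comm, ← hpe]
      exact mul_le_mul (pow_le_of_le_one (norm_nonneg _) hpe1 hk) (hb a k) (norm_nonneg _)
        (norm_nonneg _)

/-- A distribution of order `o(log)` is determined by its values on the balls. -/
theorem Distribution.IsLittleOLog.eq_of_onBall_eq {ν₁ ν₂ : Distribution p K}
    (h₁ : ν₁.IsLittleOLog) (h₂ : ν₂.IsLittleOLog) (h : ∀ b n, ν₁.onBall b n = ν₂.onBall b n) :
    ν₁ = ν₂ := by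
  have hp : p.Prime := Fact.out
  have hp0 : (0 : ℝ) < p := by exact_mod_cast hp.pos
  have hstep : ∀ g n, ν₁.toLinearMap (stepFun g n) = ν₂.toLinearMap (stepFun g n) := fun g n => by
    simp only [stepFun, map_sum, map_smul]
    exact Finset.sum_congr rfl fun b _ => congrArg _ (h b n)
  refine Distribution.transform_injective ?_
  ext k
  simp only [Distribution.transform, PowerSeries.coeff_mk]
  obtain ⟨l, M, hM⟩ := LocAnalytic.exists_bddExpansion (chooseFun (p := p) K k)
  have hM0 := hM.nonneg
  rw [← sub_eq_zero, ← norm_le_zero_iff]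
  refine le_of_forall_pos_le_add fun e he => ?_
  rw [zero_add]
  -- Chosen so that the $p^n$ of the norm cancels against the approximation error $p^{-(n-l)}M$;
  -- $M+1$ avoids division by zero.
  have hpos : 0 < e / ((p : ℝ) ^ l * (M + 1)) := by positivity
  obtain ⟨n, hn1, hn2, hn⟩ := ((h₁.eventually_norm_le hpos).and
    ((h₂.eventually_norm_le hpos).and (eventually_ge_atTop l))).exists
  set f : LocAnalytic p K := chooseFun K k - stepFun (chooseFun (p := p) K k) n with hf
  have hfb : BddExpansion n ((p : ℝ)⁻¹ ^ (n - l) * M) (f : ℤ_[p] → K) := hM.sub_stepFun hn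
  have hle : e / ((p : ℝ) ^ l * (M + 1)) * (p : ℝ) ^ n * ((p : ℝ)⁻¹ ^ (n - l) * M) ≤ e := by
    obtain ⟨m, rfl⟩ := Nat.exists_eq_add_of_le hn
    rw [Nat.add_sub_cancel_left]
    calc _ = e * (M / (M + 1)) := by
          rw [pow_add, inv_pow]
          field_simp
      _ ≤ e := mul_le_of_le_one_right he.le (div_le_one_of_le₀ (by linarith) (by linarith))
  have h3 : ν₁.toLinearMap (chooseFun K k) - ν₂.toLinearMap (chooseFun K k) =
      ν₁.toLinearMap f + -ν₂.toLinearMap f := by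
    rw [hf, map_sub, map_sub, hstep]
    ring
  rw [h3]
  refine (IsUltrametricDist.norm_add_le_max _ _).trans (max_le ?_ ?_)
  · exact (hn1 f _ hfb).trans hle
  · rw [norm_neg]
    exact (hn2 f _ hfb).trans hle

end LogGrowth

/-! ### Riemann sums for additive masses of moderate growth. -/

theorem sum_range_mul_eq {A : Type*} [AddCommMonoid A] (f : ℕ → A) (m k : ℕ) :
    ∑ y ∈ Finset.range (m * k), f y =
      ∑ x ∈ Finset.range m, ∑ j ∈ Finset.range k, f (x + m * j) := by
  induction k with
  | zero => simp
  | succ k ih =>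
    rw [mul_add_one, Finset.sum_range_add, ih, ← Finset.sum_add_distrib]
    refine Finset.sum_congr rfl fun x _ => ?_
    rw [Finset.sum_range_succ, add_comm (m * k) x]

section RiemannSums

variable {p : ℕ} [Fact p.Prime] {K : Type*} [NormedField K]

/-- The Riemann sum of `f` for the values `V n x` on the balls `x + p^n ℤ_p`, `0 ≤ x < p^n`. -/
noncomputable def riemannSum (V : ℕ → ℕ → K) (n : ℕ) (f : ℤ_[p] → K) : K :=
  ∑ x ∈ Finset.range (p ^ n), f x * V n x

variable {V : ℕ → ℕ → K}

/-- Additivity distributes the mass of each ball over its $p$ sub-balls, so that only variations of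
$f$ inside balls remain. -/
theorem riemannSum_succ_sub
    (hadd : ∀ n x, x < p ^ n → ∑ j ∈ Finset.range p, V (n + 1) (x + p ^ n * j) = V n x)
    (n : ℕ) (f : ℤ_[p] → K) :
    riemannSum V (n + 1) f - riemannSum V n f = ∑ x ∈ Finset.range (p ^ n),
      ∑ j ∈ Finset.range p, (f (x + (p : ℤ_[p]) ^ n * j) - f x) * V (n + 1) (x + p ^ n * j) := by
  rw [riemannSum, riemannSum, pow_succ, sum_range_mul_eq, ← Finset.sum_sub_distrib]
  refine Finset.sum_congr rfl fun x hx => ?_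
  rw [← hadd n x (Finset.mem_range.1 hx), Finset.mul_sum, ← Finset.sum_sub_distrib]
  refine Finset.sum_congr rfl fun j _ => ?_
  push_cast
  ring

variable [NormedAlgebra ℚ_[p] K] [IsUltrametricDist K] [CompleteSpace K] {C t : ℝ}

theorem norm_riemannSum_succ_sub_le
    (hadd : ∀ n x, x < p ^ n → ∑ j ∈ Finset.range p, V (n + 1) (x + p ^ n * j) = V n x)
    (hbd : ∀ n x, x < p ^ n → ‖V n x‖ ≤ C * t ^ n) (ht : 0 ≤ t) {h n : ℕ} (hn : h ≤ n) {M : ℝ}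
    {f : ℤ_[p] → K} (hf : BddExpansion h M f) :
    ‖riemannSum V (n + 1) f - riemannSum V n f‖ ≤ M * (C * t ^ (h + 1)) * (t / p) ^ (n - h) := by
  have hp : p.Prime := Fact.out
  have hM := hf.nonneg
  have hC : 0 ≤ C := by simpa using (norm_nonneg _).trans (hbd 0 0 (by simp))
  rw [riemannSum_succ_sub hadd]
  refine IsUltrametricDist.norm_sum_le_of_forall_le_of_nonneg (by positivity) fun x hx => ?_
  refine IsUltrametricDist.norm_sum_le_of_forall_le_of_nonneg (by positivity) fun j hj => ?_
  rw [norm_mul]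
  have hlt : x + p ^ n * j < p ^ (n + 1) := by
    have h1 := Finset.mem_range.1 hx
    have h2 := Finset.mem_range.1 hj
    calc x + p ^ n * j < p ^ n * (j + 1) := by rw [mul_add_one]; omega
      _ ≤ p ^ n * p := Nat.mul_le_mul_left _ h2
      _ = p ^ (n + 1) := (pow_succ _ _).symm
  calc _ ≤ ((p : ℝ)⁻¹ ^ (n - h) * M) * (C * t ^ (n + 1)) :=
        mul_le_mul (hf.norm_sub_le hn _ _) (hbd _ _ hlt) (norm_nonneg _) (by positivity)
    _ = M * (C * t ^ (h + 1)) * (t / p) ^ (n - h) := by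
        obtain ⟨m, rfl⟩ := Nat.exists_eq_add_of_le hn
        rw [Nat.add_sub_cancel_left, div_eq_mul_inv, mul_pow]
        ring

/-- By the ultrametric inequality the sum at level $n$ is no larger than the sum at level $h$ or one
of the later corrections, which decrease since $t<p$. The resulting rate $t^h$ is what yields order
$o(\log)$. -/
theorem norm_riemannSum_le
    (hadd : ∀ n x, x < p ^ n → ∑ j ∈ Finset.range p, V (n + 1) (x + p ^ n * j) = V n x)
    (hbd : ∀ n x, x < p ^ n → ‖V n x‖ ≤ C * t ^ n) (ht : 1 ≤ t) (htp : t < p) {h n : ℕ}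
    (hn : h ≤ n) {M : ℝ} {f : ℤ_[p] → K} (hf : BddExpansion h M f) :
    ‖riemannSum V n f‖ ≤ C * t ^ (h + 1) * M := by
  have hM := hf.nonneg
  have hC : 0 ≤ C := by simpa using (norm_nonneg _).trans (hbd 0 0 (by simp))
  have ht0 : 0 ≤ t := zero_le_one.trans ht
  induction n, hn using Nat.le_induction with
  | base =>
    refine IsUltrametricDist.norm_sum_le_of_forall_le_of_nonneg (by positivity) fun x hx => ?_
    rw [norm_mul, mul_comm]
    refine mul_le_mul ((hbd _ _ (Finset.mem_range.1 hx)).trans ?_) (hf.norm_le _)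
      (norm_nonneg _) (by positivity)
    exact mul_le_mul_of_nonneg_left (pow_le_pow_right₀ ht (Nat.le_succ h)) hC
  | succ n hn ih =>
    rw [← sub_add_cancel (riemannSum V (n + 1) f) (riemannSum V n f)]
    refine (IsUltrametricDist.norm_add_le_max _ _).trans (max_le ?_ ih)
    refine (norm_riemannSum_succ_sub_le hadd hbd ht0 hn hf).trans ?_
    rw [mul_comm (C * t ^ (h + 1))]
    refine mul_le_of_le_one_right (by positivity) (pow_le_one₀ (by positivity) ?_)
    exact div_le_one_of_le₀ htp.le (by positivity)

theorem cauchySeq_riemannSum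
    (hadd : ∀ n x, x < p ^ n → ∑ j ∈ Finset.range p, V (n + 1) (x + p ^ n * j) = V n x)
    (hbd : ∀ n x, x < p ^ n → ‖V n x‖ ≤ C * t ^ n) (ht : 0 ≤ t) (htp : t < p) {h : ℕ} {M : ℝ}
    {f : ℤ_[p] → K} (hf : BddExpansion h M f) : CauchySeq fun n => riemannSum V n f := by
  have hp : p.Prime := Fact.out
  have hp0 : (0 : ℝ) < p := by exact_mod_cast hp.pos
  have : CauchySeq fun n => riemannSum V (n + h) f := by
    refine cauchySeq_of_le_geometric (t / p) (M * (C * t ^ (h + 1))) ((div_lt_one hp0).2 htp)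
      fun n => ?_
    rw [dist_comm, dist_eq_norm, add_right_comm]
    have := norm_riemannSum_succ_sub_le hadd hbd ht (Nat.le_add_left h n) hf
    rwa [Nat.add_sub_cancel] at this
  obtain ⟨l, hl⟩ := cauchySeq_tendsto_of_complete this
  exact ((tendsto_add_atTop_iff_nat h).1 hl).cauchySeq

/-- An additive function on the balls that grows like `t^n` with `t < p` extends, by Riemann sums,
to a distribution of order `o(log)`. -/
theorem exists_distribution
    (hadd : ∀ n x, x < p ^ n → ∑ j ∈ Finset.range p, V (n + 1) (x + p ^ n * j) = V n x)
    (hbd : ∀ n x, x < p ^ n → ‖V n x‖ ≤ C * t ^ n) (ht : 1 ≤ t) (htp : t < p) :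
    ∃ μ : Distribution p K,
      (∀ f : LocAnalytic p K, Tendsto (fun n => riemannSum V n (f : ℤ_[p] → K)) atTop
        (𝓝 (μ.toLinearMap f))) ∧
      (∀ n x, x < p ^ n → ∀ w : ℤ_[p], μ.onBall (x + (p : ℤ_[p]) ^ n * w) n = V n x) ∧
      μ.IsLittleOLog := by
  have hp : p.Prime := Fact.out
  have ht0 : 0 ≤ t := zero_le_one.trans ht
  have hex : ∀ f : LocAnalytic p K, ∃ l, Tendsto (fun n => riemannSum V n (f : ℤ_[p] → K)) atTop
      (𝓝 l) := fun f => by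
    obtain ⟨h, M, hf⟩ := LocAnalytic.exists_bddExpansion f
    exact cauchySeq_tendsto_of_complete (cauchySeq_riemannSum hadd hbd ht0 htp hf)
  choose I hI using hex
  have hnorm : ∀ (f : LocAnalytic p K) (h : ℕ) (M : ℝ), BddExpansion h M (f : ℤ_[p] → K) →
      ‖I f‖ ≤ C * t ^ (h + 1) * M := fun f h M hf => by
    refine le_of_tendsto (hI f).norm ?_
    filter_upwards [eventually_ge_atTop h] with n hn
    exact norm_riemannSum_le hadd hbd ht htp hn hf
  set μ : Distribution p K :=
    { toLinearMap :=
        { toFun := I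
          map_add' := fun f g => by
            refine tendsto_nhds_unique (hI (f + g)) ?_
            simpa [riemannSum, add_mul, Finset.sum_add_distrib] using (hI f).add (hI g)
          map_smul' := fun s f => by
            refine tendsto_nhds_unique (hI (s • f)) ?_
            simpa [riemannSum, mul_assoc, Finset.mul_sum] using (hI f).const_mul s }
      bounded := fun h => ⟨C * t ^ (h + 1), fun f c M hc hb => hnorm f h M ⟨c, hc, hb⟩⟩ } with hμ
  have hμI : ∀ f, μ.toLinearMap f = I f := fun f => rfl
  refine ⟨μ, hI, fun n x hx w => ?_, ?_⟩
  · rw [Distribution.onBall, hμI]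
    refine tendsto_nhds_unique (hI _) (tendsto_const_nhds.congr' ?_)
    filter_upwards [eventually_ge_atTop n] with m hm
    have hball : ball ((x : ℤ_[p]) + (p : ℤ_[p]) ^ n * w) n = ball (x : ℤ_[p]) n := by
      ext y
      exact ⟨fun ⟨z, hz⟩ => ⟨w + z, by rw [hz]; ring⟩, fun ⟨z, hz⟩ => ⟨z - w, by rw [hz]; ring⟩⟩
    have hfun : (ballFun K ((x : ℤ_[p]) + (p : ℤ_[p]) ^ n * w) n : ℤ_[p] → K) =
        (ball (x : ℤ_[p]) n).indicator fun _ => 1 :=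
      congrArg (fun s => s.indicator fun _ => (1 : K)) hball
    rw [hfun]
    -- From level $n$ on, the Riemann sums of the indicator are constant: it does not vary on the
    -- balls of radius $p^{-m}$, $m\ge n$.
    induction m, hm using Nat.le_induction with
    | base =>
      rw [riemannSum, Finset.sum_eq_single_of_mem x (Finset.mem_range.2 hx)]
      · rw [Set.indicator_of_mem (show (x : ℤ_[p]) ∈ ball (x : ℤ_[p]) n from ⟨0, by simp⟩), one_mul]
      · intro y hy hyx
        rw [Set.indicator_of_notMem, zero_mul]
        intro h
        refine hyx ((natCast_add_mem_ball_iff hx (Finset.mem_range.1 hy) 0).1 ?_).symm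
        simpa using h
    | succ m hm ih =>
      rw [ih, ← sub_eq_zero, ← neg_sub, neg_eq_zero, riemannSum_succ_sub hadd]
      refine Finset.sum_eq_zero fun y _ => Finset.sum_eq_zero fun j _ => ?_
      have h1 : ((y : ℤ_[p]) + (p : ℤ_[p]) ^ m * j ∈ ball (x : ℤ_[p]) n) ↔
          (y : ℤ_[p]) ∈ ball (x : ℤ_[p]) n := by
        have h2 : (p : ℤ_[p]) ^ m = (p : ℤ_[p]) ^ n * (p : ℤ_[p]) ^ (m - n) := by
          rw [← pow_add, Nat.add_sub_cancel' hm]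
        exact ⟨fun ⟨z, hz⟩ => ⟨z - (p : ℤ_[p]) ^ (m - n) * j, by
            rw [h2] at hz; linear_combination hz⟩,
          fun ⟨z, hz⟩ => ⟨z + (p : ℤ_[p]) ^ (m - n) * j, by rw [h2]; linear_combination hz⟩⟩
      by_cases hy : (y : ℤ_[p]) ∈ ball (x : ℤ_[p]) n
      · rw [Set.indicator_of_mem hy, Set.indicator_of_mem (h1.2 hy), sub_self, zero_mul]
      · rw [Set.indicator_of_notMem hy, Set.indicator_of_notMem (fun h => hy (h1.1 h)), sub_self,
          zero_mul]
  -- For $k<p^h$ the function $\binom{x}{k}$ has norm at most $1$ at level $h$.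
  · refine isLittleOLog_of_norm_coeff_le (C := C * t) ht0 htp fun h k hk => ?_
    have h1 := bddExpansion_choose (p := p) (K := K) h k
    rw [Nat.div_eq_of_lt hk, pow_zero] at h1
    have h2 := hnorm (chooseFun K k) h 1 h1
    rw [Distribution.transform, PowerSeries.coeff_mk, hμI]
    calc ‖I (chooseFun K k)‖ ≤ _ := h2
      _ = C * t * t ^ h := by ring

end RiemannSums

/-! ### Digit expansion of the cyclotomic matrix product. -/

section Digits

variable {K : Type*} [NormedField K]

/-- The factor contributed by the digit `j` to `digitProduct`. -/
def digitFactor (a ε : K) (j : ℕ) : Matrix (Fin 2) (Fin 2) K :=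
  if j = 0 then !![a, 1; -ε, 0] else !![0, 0; -ε, 0]

/-- A leading zero lengthens the first run and so contributes $Y$; a nonzero digit opens a new empty
run, whose separator is $N$. -/
theorem digitProduct_cons (a ε : K) (j : ℕ) (d : List ℕ) :
    digitProduct a ε (j :: d) = digitFactor a ε j * digitProduct a ε d := by
  have hne : d.splitOnP (fun x => decide (x ≠ 0)) ≠ [] := List.splitOnP_ne_nil _ _
  obtain ⟨l, L, hL⟩ := List.exists_cons_of_ne_nil hne
  rw [digitProduct, digitProduct, zeroRuns, zeroRuns, List.splitOnP_cons_eq_if_modifyHead, hL]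
  by_cases hj : j = 0
  · rw [if_neg (by simpa using hj), digitFactor, if_pos hj]
    cases L with
    | nil => simp [pow_succ']
    | cons l' L' => simp [pow_succ']
  · rw [if_pos (by simpa using hj), digitFactor, if_neg hj]
    simp

theorem digitProduct_eq_prod (a ε : K) (d : List ℕ) :
    digitProduct a ε d = (d.map (digitFactor a ε)).prod := by
  induction d with
  | nil => simp [digitProduct, zeroRuns]
  | cons j d ih => rw [digitProduct_cons, ih, List.map_cons, List.prod_cons]

variable (p : ℕ) (a ε α β : K)

/-- `digitProduct` for the first `n` base-`p` digits of `x`. -/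
def digitMatrix (n x : ℕ) : Matrix (Fin 2) (Fin 2) K :=
  digitProduct a ε (List.ofFn fun l : Fin n => x / p ^ (l : ℕ) % p)

theorem digitMatrix_succ {n x j : ℕ} (hx : x < p ^ n) (hj : j < p) :
    digitMatrix p a ε (n + 1) (x + p ^ n * j) = digitMatrix p a ε n x * digitFactor a ε j := by
  have hp : 0 < p := by omega
  rw [digitMatrix, digitMatrix, digitProduct_eq_prod, digitProduct_eq_prod, List.ofFn_succ',
    List.concat_eq_append, List.map_append, List.prod_append]
  congr 1
  · congr 3
    funext l
    have h1 : p ^ n = p ^ (l : ℕ) * (p * p ^ (n - l - 1)) := by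
      rw [← pow_succ', ← pow_add]
      congr 1
      omega
    rw [Fin.val_castSucc, h1, mul_assoc, Nat.add_mul_div_left _ _ (pow_pos hp _), mul_assoc,
      Nat.add_mul_mod_self_left]
  · rw [Fin.val_last, Nat.add_mul_div_left _ _ (pow_pos hp _), Nat.div_eq_of_lt hx, zero_add,
      Nat.mod_eq_of_lt hj]
    simp

theorem sum_digitFactor (hp : 0 < p) :
    ∑ j ∈ Finset.range p, digitFactor a ε j = !![a, 1; -ε * p, 0] := by
  obtain ⟨m, rfl⟩ : ∃ m, p = m + 1 := ⟨p - 1, by omega⟩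
  rw [Finset.sum_range_succ']
  simp only [digitFactor, Nat.succ_ne_zero, if_false, if_true, Finset.sum_const,
    Finset.card_range]
  ext i j
  fin_cases i <;> fin_cases j <;> simp
  ring

/-- The term $j=0$ of $\Phi_{p^{n+1}}(1+T)=\sum_{j<p}(1+T)^{p^nj}$ is kept together with the
constant entries $a$ and $1$, giving $Y$; every other term gives $N$. -/
theorem logFactor_eq_sum [Fact p.Prime] (n : ℕ) :
    logFactor p a ε (n + 1) = ∑ j ∈ Finset.range p,
      ((1 + Polynomial.X : Polynomial K) ^ (p ^ n * j)) •
        (digitFactor a ε j).map Polynomial.C := by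
  have hp : p.Prime := Fact.out
  rw [logFactor, Polynomial.cyclotomic_prime_pow_eq_geom_sum hp]
  obtain ⟨m, hm⟩ : ∃ m, p = m + 1 := ⟨p - 1, by have := hp.pos; omega⟩
  have hsum : (∑ i ∈ Finset.range p, (Polynomial.X ^ p ^ n) ^ i : Polynomial K).comp
      (1 + Polynomial.X) =
        ∑ i ∈ Finset.range p, (1 + Polynomial.X : Polynomial K) ^ (p ^ n * i) := by
    rw [Polynomial.sum_comp]
    refine Finset.sum_congr rfl fun i _ => ?_
    simp [pow_mul]
  rw [hsum]
  generalize p ^ n = q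
  rw [hm, Finset.sum_range_succ', Finset.sum_range_succ']
  simp only [digitFactor, Nat.succ_ne_zero, if_false, if_true]
  ext i j : 2
  fin_cases i <;> fin_cases j <;>
    simp [Matrix.sum_apply, mul_add, Finset.mul_sum, mul_comm]

theorem prod_logFactor_eq_sum [Fact p.Prime] (n : ℕ) :
    ((List.range n).map fun i => logFactor p a ε (i + 1)).prod = ∑ x ∈ Finset.range (p ^ n),
      ((1 + Polynomial.X : Polynomial K) ^ x) • (digitMatrix p a ε n x).map Polynomial.C := by
  induction n with
  | zero => simp [digitMatrix, digitProduct_eq_prod, Matrix.map_one]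
  | succ n ih =>
    rw [List.range_succ, List.map_append, List.prod_append, ih, pow_succ, sum_range_mul_eq,
      List.map_singleton, List.prod_singleton, logFactor_eq_sum, Finset.sum_mul]
    refine Finset.sum_congr rfl fun x hx => ?_
    rw [Finset.mul_sum]
    refine Finset.sum_congr rfl fun j hj => ?_
    rw [digitMatrix_succ p a ε (Finset.mem_range.1 hx) (Finset.mem_range.1 hj), Matrix.map_mul,
      pow_add, smul_mul_smul_comm]

theorem coeff_logApprox [Fact p.Prime] (n k : ℕ) (i j : Fin 2) :
    (logApprox p a ε α β n i j).coeff k = ∑ x ∈ Finset.range (p ^ n),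
      (x.choose k : K) * (digitMatrix p a ε n x * rootMatrix p a ε α β n) i j := by
  rw [logApprox, prod_logFactor_eq_sum, Finset.sum_mul, Matrix.sum_apply,
    Polynomial.finsetSum_coeff]
  refine Finset.sum_congr rfl fun x _ => ?_
  rw [Matrix.smul_mul, ← Matrix.map_mul, Matrix.smul_apply, Matrix.map_apply, smul_eq_mul,
    Polynomial.coeff_mul_C, Polynomial.coeff_one_add_X_pow]

theorem norm_digitMatrix_le [IsUltrametricDist K] {a ε : K} (ha : ‖a‖ ≤ 1) (hε : ‖ε‖ ≤ 1)
    (n x : ℕ) (i j : Fin 2) : ‖digitMatrix p a ε n x i j‖ ≤ 1 := by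
  rw [digitMatrix, digitProduct_eq_prod]
  generalize (List.ofFn fun l : Fin n => x / p ^ (l : ℕ) % p) = d
  induction d generalizing i j with
  | nil =>
    rw [List.map_nil, List.prod_nil, Matrix.one_apply]
    split_ifs <;> simp
  | cons l d ih =>
    rw [List.map_cons, List.prod_cons, Matrix.mul_apply]
    refine IsUltrametricDist.norm_sum_le_of_forall_le_of_nonneg zero_le_one fun r _ => ?_
    rw [norm_mul]
    refine mul_le_one₀ ?_ (norm_nonneg _) (ih r j)
    rw [digitFactor]
    split_ifs <;> fin_cases i <;> fin_cases r <;> simp [ha, hε]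

end Digits

/-! ### The matrix of roots: compatibility and eigenvectors. -/

section Roots

variable {K : Type*} [NormedField K] {p : ℕ} {a ε α β : K}

theorem mul_rootMatrix_succ (h0 : ε * p ≠ 0) (n : ℕ) :
    !![a, 1; -ε * p, 0] * rootMatrix p a ε α β (n + 1) = rootMatrix p a ε α β n := by
  have hdet : IsUnit (!![a, 1; -ε * p, 0] : Matrix (Fin 2) (Fin 2) K).det := by
    rw [Matrix.det_fin_two_of]
    exact (by simpa using h0 : a * 0 - 1 * (-ε * p) ≠ 0).isUnit
  rw [rootMatrix, rootMatrix, ← add_assoc, pow_succ', mul_assoc, ← mul_assoc,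
    Matrix.mul_nonsing_inv _ hdet, one_mul]

/-- With $a=\alpha+\beta$ and $\varepsilon p=\alpha\beta$, the vectors $(-1,\beta)$ and
$(-1,\alpha)$ are eigenvectors for $\alpha$ and $\beta$. This separates the growth rates of the two
columns of $R_n$. -/
theorem rootMatrix_eq (h0 : ε * p ≠ 0) (ha : a = α + β) (hε : ε * p = α * β) (n : ℕ) :
    rootMatrix p a ε α β n = !![-1, -1; β, α] *
      Matrix.diagonal (![α, β]⁻¹ ^ ((if p = 2 then 3 else 2) + n)) := by
  have hα : α ≠ 0 := by rintro rfl; simp [hε] at h0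
  have hβ : β ≠ 0 := by rintro rfl; simp [hε] at h0
  have hdet : IsUnit (!![a, 1; -ε * p, 0] : Matrix (Fin 2) (Fin 2) K).det := by
    rw [Matrix.det_fin_two_of]
    exact (by simpa using h0 : a * 0 - 1 * (-ε * p) ≠ 0).isUnit
  have h1 : !![a, 1; -ε * p, 0]⁻¹ * !![-1, -1; β, α] =
      !![-1, -1; β, α] * Matrix.diagonal ![α, β]⁻¹ := by
    have h2 : (!![-1, -1; β, α] : Matrix (Fin 2) (Fin 2) K) = !![a, 1; -ε * p, 0] *
        (!![-1, -1; β, α] * Matrix.diagonal ![α, β]⁻¹) := by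
      rw [neg_mul, hε, ha]
      ext i j
      rw [Matrix.mul_apply, Fin.sum_univ_two, Matrix.mul_diagonal, Matrix.mul_diagonal]
      fin_cases i <;> fin_cases j <;> simp <;> field_simp <;> ring
    conv_lhs => rw [h2]
    rw [← mul_assoc, Matrix.nonsing_inv_mul _ hdet, one_mul]
  rw [rootMatrix]
  generalize (if p = 2 then 3 else 2) + n = m
  induction m with
  | zero => simp
  | succ m ih =>
    rw [pow_succ', mul_assoc, ih, ← mul_assoc, h1, mul_assoc, Matrix.diagonal_mul_diagonal']
    congr 2
    rw [pow_succ']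
    rfl

end Roots

/-! ### Distributions attached to the entries of the logarithm matrix. -/

section Entries

variable {p : ℕ} [Fact p.Prime] {K : Type*} [NormedField K]

theorem HasDigits.exists_digitMatrix_eq {b : ℤ_[p]} {n : ℕ} {d : Fin n → Fin p}
    (hd : HasDigits b d) : ∃ x < p ^ n, (∃ w, b = x + (p : ℤ_[p]) ^ n * w) ∧
      ∀ a ε : K, digitMatrix p a ε n x = digitProduct a ε (List.ofFn fun i => (d i : ℕ)) := by
  obtain ⟨w, hw⟩ := Ideal.mem_span_singleton.1 hd
  refine ⟨finFunctionFinEquiv d, (finFunctionFinEquiv d).2, ⟨w, ?_⟩, fun a ε => ?_⟩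
  · rw [finFunctionFinEquiv_apply_val]
    push_cast
    linear_combination hw
  · rw [digitMatrix]
    congr 2
    funext l
    have := congrFun (finFunctionFinEquiv.symm_apply_apply d) l
    exact congrArg Fin.val this

theorem exists_hasDigits (b : ℤ_[p]) (n : ℕ) : ∃ d : Fin n → Fin p, HasDigits b d := by
  refine ⟨finFunctionFinEquiv.symm ⟨b.appr n, PadicInt.appr_lt b n⟩, ?_⟩
  have h1 := PadicInt.appr_spec n b
  have h2 := congrArg (fun y : Fin (p ^ n) => ((y : ℕ) : ℤ_[p]))
    (finFunctionFinEquiv.apply_symm_apply ⟨b.appr n, PadicInt.appr_lt b n⟩)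
  simp only [finFunctionFinEquiv_apply_val] at h2
  push_cast at h2
  rw [HasDigits, h2]
  exact h1

variable [NormedAlgebra ℚ_[p] K]

variable (p K) in
theorem norm_prime_eq : ‖(p : K)‖ = (p : ℝ)⁻¹ := by
  rw [norm_natCast_eq_padic p K, Padic.norm_p]

theorem isUltrametricDist_of_normedAlgebra_padic (p : ℕ) [Fact p.Prime] (K : Type*) [NormedField K]
    [NormedAlgebra ℚ_[p] K] : IsUltrametricDist K := by
  refine IsUltrametricDist.isUltrametricDist_of_forall_norm_natCast_le_one fun n => ?_
  rw [norm_natCast_eq_padic p K]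
  exact IsUltrametricDist.norm_natCast_le_one _ _

variable [IsUltrametricDist K] [CompleteSpace K] {a ε α β : K}

/-- The distribution attached to an entry of the logarithm matrix in a column where the root of
the Hecke polynomial has slope less than one. -/
theorem exists_distribution_entry (ha : ‖a‖ ≤ 1) (hε : ‖ε‖ = 1) (hsum : a = α + β)
    (hprod : ε * p = α * β) (hα : ‖α‖ ≤ 1) (hβ : ‖β‖ ≤ 1) (i j : Fin 2)
    (hj : (p : ℝ)⁻¹ < ‖![α, β] j‖) :
    ∃ μ : Distribution p K,
      (∀ k, Tendsto (fun n : ℕ => (logApprox p a ε α β n i j).coeff k) atTop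
        (𝓝 (μ.transform.coeff k))) ∧
      (∀ (n : ℕ) (b : ℤ_[p]) (d : Fin n → Fin p), HasDigits b d →
        μ.onBall b n = digitValue p a ε α β d i j) ∧
      μ.IsLittleOLog := by
  have hp : p.Prime := Fact.out
  have hp0 : (0 : ℝ) < p := by exact_mod_cast hp.pos
  have h0 : ε * p ≠ 0 := by
    rw [← norm_ne_zero_iff, norm_mul, hε, norm_prime_eq p K, one_mul]
    positivity
  set s := ‖![α, β] j‖ with hs
  have hs0 : 0 < s := (by positivity : (0 : ℝ) < (p : ℝ)⁻¹).trans hj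
  have hs1 : s ≤ 1 := by rw [hs]; fin_cases j <;> simp [hα, hβ]
  set c := if p = 2 then 3 else 2
  have hadd : ∀ n x, x < p ^ n → ∑ l ∈ Finset.range p,
      (digitMatrix p a ε (n + 1) (x + p ^ n * l) * rootMatrix p a ε α β (n + 1)) i j =
        (digitMatrix p a ε n x * rootMatrix p a ε α β n) i j := fun n x hx => by
    rw [← Matrix.sum_apply, ← Finset.sum_mul,
      Finset.sum_congr rfl fun l hl => digitMatrix_succ p a ε hx (Finset.mem_range.1 hl),
      ← Finset.mul_sum, sum_digitFactor p a ε hp.pos, mul_assoc, mul_rootMatrix_succ h0]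
  -- The digit matrix and the eigenvector matrix are integral, so column $j$ grows only through the
  -- inverse powers of its root; the shift $c$ affects only the constant.
  have hbd : ∀ n x, x < p ^ n →
      ‖(digitMatrix p a ε n x * rootMatrix p a ε α β n) i j‖ ≤ s⁻¹ ^ c * s⁻¹ ^ n := fun n x _ => by
    rw [rootMatrix_eq h0 hsum hprod, ← mul_assoc, Matrix.mul_diagonal, norm_mul, ← pow_add,
      Pi.pow_apply, Pi.inv_apply, norm_pow, norm_inv]
    refine mul_le_of_le_one_left (by positivity) ?_
    rw [Matrix.mul_apply]
    refine IsUltrametricDist.norm_sum_le_of_forall_le_of_nonneg zero_le_one fun r _ => ?_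
    rw [norm_mul]
    refine mul_le_one₀ (norm_digitMatrix_le p ha hε.le n x i r) (norm_nonneg _) ?_
    fin_cases r <;> fin_cases j <;> simp [hα, hβ]
  obtain ⟨μ, h1, h2, h3⟩ := exists_distribution (p := p)
    (V := fun n x => (digitMatrix p a ε n x * rootMatrix p a ε α β n) i j)
    hadd hbd ((one_le_inv₀ hs0).2 hs1) (inv_lt_of_inv_lt₀ hp0 hj)
  refine ⟨μ, fun k => ?_, fun n b d hd => ?_, h3⟩
  · rw [Distribution.transform, PowerSeries.coeff_mk]
    refine (h1 (chooseFun K k)).congr fun n => ?_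
    rw [coeff_logApprox, riemannSum]
    refine Finset.sum_congr rfl fun x _ => ?_
    simp [chooseFun, Ring.choose_natCast]
  · obtain ⟨x, hx, ⟨w, rfl⟩, hdm⟩ := hd.exists_digitMatrix_eq (K := K)
    rw [h2 n x hx w, digitValue, hdm]

/-- Characterization of a distribution whose transform is an entry of the logarithm matrix. -/
theorem entry_spec (ha : ‖a‖ ≤ 1) (hε : ‖ε‖ = 1) (hsum : a = α + β)
    (hprod : ε * p = α * β) (hα : ‖α‖ ≤ 1) (hβ : ‖β‖ ≤ 1) (i j : Fin 2)
    (hj : (p : ℝ)⁻¹ < ‖![α, β] j‖) :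
    (∀ k, Tendsto (fun n : ℕ => (logApprox p a ε α β n i j).coeff k) atTop
      (𝓝 ((logMatrix p a ε α β i j).coeff k))) ∧
    ∃ μ : Distribution p K, μ.transform = logMatrix p a ε α β i j ∧
      ∀ ν : Distribution p K, ν.transform = logMatrix p a ε α β i j → ν = μ ∧
        (∀ (n : ℕ) (b : ℤ_[p]) (d : Fin n → Fin p), HasDigits b d →
          ν.onBall b n = digitValue p a ε α β d i j) ∧ ν.IsLittleOLog ∧
        ∀ ν' : Distribution p K, ν'.IsLittleOLog →
          (∀ (n : ℕ) (b : ℤ_[p]) (d : Fin n → Fin p), HasDigits b d →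
            ν'.onBall b n = digitValue p a ε α β d i j) → ν' = ν := by
  obtain ⟨μ, h1, h2, h3⟩ := exists_distribution_entry ha hε hsum hprod hα hβ i j hj
  have hT : μ.transform = logMatrix p a ε α β i j := by
    ext k
    rw [logMatrix, Matrix.of_apply, PowerSeries.coeff_mk, (h1 k).limUnder_eq]
  refine ⟨fun k => hT ▸ h1 k, μ, hT, fun ν hν => ?_⟩
  obtain rfl : ν = μ := Distribution.transform_injective (hν.trans hT.symm)
  refine ⟨rfl, h2, h3, fun ν' h4 h5 => h4.eq_of_onBall_eq h3 fun b n => ?_⟩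
  obtain ⟨d, hd⟩ := exists_hasDigits b n
  rw [h5 n b d hd, h2 n b d hd]

end Entries

end PadicLog

/-! ### The main theorem: sizes of the roots in the two cases. -/

theorem mainTheorem1 (p : ℕ) [Fact p.Prime]
    (K : Type*) [NormedField K] [NormedAlgebra ℚ_[p] K] [CompleteSpace K]
    (a ε α β : K) (ha : ‖a‖ ≤ 1) (hε : ‖ε‖ = 1)
    (hroots : (Polynomial.X ^ 2 - Polynomial.C a * Polynomial.X + Polynomial.C (ε * p) :
      Polynomial K) = (Polynomial.X - Polynomial.C α) * (Polynomial.X - Polynomial.C β))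
    (hαβ : ‖β‖ ≤ ‖α‖) :
    -- supersingular case
    (‖a‖ < 1 →
      (∀ i j k, Tendsto (fun n : ℕ => (logApprox p a ε α β n i j).coeff k) atTop
        (𝓝 ((logMatrix p a ε α β i j).coeff k))) ∧
      (∃! μ : Matrix (Fin 2) (Fin 2) (Distribution p K),
        matrixTransform μ = logMatrix p a ε α β) ∧
      ∀ μ : Matrix (Fin 2) (Fin 2) (Distribution p K),
        matrixTransform μ = logMatrix p a ε α β →
        (∀ (n : ℕ) (b : ℤ_[p]) (d : Fin n → Fin p), HasDigits b d →
          matrixOnBall μ b n = digitValue p a ε α β d) ∧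
        (∀ i j, (μ i j).IsLittleOLog) ∧
        ∀ ν : Matrix (Fin 2) (Fin 2) (Distribution p K), (∀ i j, (ν i j).IsLittleOLog) →
          (∀ (n : ℕ) (b : ℤ_[p]) (d : Fin n → Fin p), HasDigits b d →
            matrixOnBall ν b n = digitValue p a ε α β d) →
          ν = μ) ∧
    -- ordinary case: the first column only
    (‖a‖ = 1 →
      (∀ i k, Tendsto (fun n : ℕ => (logApprox p a ε α β n i 0).coeff k) atTop
        (𝓝 ((logMatrix p a ε α β i 0).coeff k))) ∧
      (∃! μ : Fin 2 → Distribution p K, ∀ i, (μ i).transform = logMatrix p a ε α β i 0) ∧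
      ∀ μ : Fin 2 → Distribution p K, (∀ i, (μ i).transform = logMatrix p a ε α β i 0) →
        (∀ (n : ℕ) (b : ℤ_[p]) (d : Fin n → Fin p), HasDigits b d →
          ∀ i, (μ i).onBall b n = digitValue p a ε α β d i 0) ∧
        (∀ i, (μ i).IsLittleOLog) ∧
        ∀ ν : Fin 2 → Distribution p K, (∀ i, (ν i).IsLittleOLog) →
          (∀ (n : ℕ) (b : ℤ_[p]) (d : Fin n → Fin p), HasDigits b d →
            ∀ i, (ν i).onBall b n = digitValue p a ε α β d i 0) →
          ν = μ) := by
  have hp : p.Prime := Fact.out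
  have hp0 : (0 : ℝ) < p := by exact_mod_cast hp.pos
  have hp1 : (p : ℝ)⁻¹ < 1 := inv_lt_one_of_one_lt₀ (by exact_mod_cast hp.one_lt)
  have : IsUltrametricDist K := isUltrametricDist_of_normedAlgebra_padic p K
  have hprod : ε * p = α * β := by
    simpa using congrArg (Polynomial.eval 0) hroots
  have hsum : a = α + β := by
    have := congrArg (Polynomial.eval 1) hroots
    simp only [Polynomial.eval_add, Polynomial.eval_sub, Polynomial.eval_mul, Polynomial.eval_pow,
      Polynomial.eval_X, Polynomial.eval_C] at this
    linear_combination hprod - this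
  have hnorm : ‖α‖ * ‖β‖ = (p : ℝ)⁻¹ := by
    rw [← norm_mul, ← hprod, norm_mul, hε, one_mul, norm_prime_eq p K]
  have hα0 : 0 < ‖α‖ := by
    refine (norm_nonneg α).lt_of_ne fun h => ?_
    rw [← h, zero_mul] at hnorm
    exact (inv_pos.2 hp0).ne hnorm
  have hmax : ‖β‖ < ‖α‖ → ‖a‖ = ‖α‖ := fun h => by
    rw [hsum, IsUltrametricDist.norm_add_eq_max_of_norm_ne_norm h.ne', max_eq_left h.le]
  have hα : ‖α‖ ≤ 1 := by
    by_contra! h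
    rcases hαβ.lt_or_eq with h' | h'
    · rw [← hmax h'] at h
      exact absurd ha (not_le.2 h)
    · rw [h'] at hnorm
      -- Here $|\alpha|=|\beta|>1$ would contradict $|\alpha||\beta|=1/p<1$.
      nlinarith
  have hβ : ‖β‖ ≤ 1 := hαβ.trans hα
  constructor
  · intro hss
    -- If $|\alpha|=1$, then $|\beta|=1/p<|\alpha|$ and the ultrametric equality forces $|a|=1$.
    have hα1 : ‖α‖ < 1 := by
      refine hα.lt_of_ne fun h => ?_
      rw [h, one_mul] at hnorm
      have := hmax (by rw [hnorm, h]; exact hp1)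
      rw [h] at this
      exact hss.ne this
    have hβ1 : (p : ℝ)⁻¹ < ‖β‖ := by
      have hβ0 : 0 < ‖β‖ := by
        refine (norm_nonneg β).lt_of_ne fun h => ?_
        rw [← h, mul_zero] at hnorm
        exact (inv_pos.2 hp0).ne hnorm
      rw [← hnorm]
      exact mul_lt_of_lt_one_left hβ0 hα1
    have hj : ∀ j, (p : ℝ)⁻¹ < ‖![α, β] j‖ := fun j => by
      fin_cases j
      · exact hβ1.trans_le hαβ
      · exact hβ1
    have key := fun i j => entry_spec ha hε hsum hprod hα hβ i j (hj j)
    choose hlim μ₀ hμ₀ hspec using key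
    have hentry : ∀ μ : Matrix (Fin 2) (Fin 2) (Distribution p K),
        matrixTransform μ = logMatrix p a ε α β →
          ∀ i j, (μ i j).transform = logMatrix p a ε α β i j := fun μ hμ i j =>
      congrFun (congrFun hμ i) j
    refine ⟨hlim, ⟨μ₀, ?_, fun μ hμ => ?_⟩, fun μ hμ => ⟨fun n b d hd => ?_, fun i j => ?_,
      fun ν h1 h2 => ?_⟩⟩
    · exact funext fun i => funext fun j => hμ₀ i j
    · ext i j : 2
      exact (hspec i j _ (hentry μ hμ i j)).1
    · ext i j
      exact (hspec i j _ (hentry μ hμ i j)).2.1 n b d hd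
    · exact (hspec i j _ (hentry μ hμ i j)).2.2.1
    · ext i j : 2
      exact (hspec i j _ (hentry μ hμ i j)).2.2.2 _ (h1 i j) fun n b d hd =>
        congrFun (congrFun (h2 n b d hd) i) j
  · intro hord
    -- Here $|\beta|=1/p$ exactly, so the strict slope bound fails for the second column.
    have hα1 : ‖α‖ = 1 := by
      refine le_antisymm hα ?_
      rw [← hord, hsum]
      exact (IsUltrametricDist.norm_add_le_max _ _).trans (max_le le_rfl hαβ)
    have hj : (p : ℝ)⁻¹ < ‖![α, β] 0‖ := by
      simpa [hα1] using hp1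
    have key := fun i => entry_spec ha hε hsum hprod hα hβ i 0 hj
    choose hlim μ₀ hμ₀ hspec using key
    refine ⟨hlim, ⟨μ₀, hμ₀, fun μ hμ => ?_⟩, fun μ hμ => ⟨fun n b d hd i => ?_, fun i => ?_,
      fun ν h1 h2 => ?_⟩⟩
    · funext i
      exact (hspec i _ (hμ i)).1
    · exact (hspec i _ (hμ i)).2.1 n b d hd
    · exact (hspec i _ (hμ i)).2.2.1
    · funext i
      exact (hspec i _ (hμ i)).2.2.2 _ (h1 i) fun n b d hd => h2 n b d hd i
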